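/- For integers $s,t\ge 1$ and $0\le r\le s-1$ let $X(s,t,r)$ be the 4-regular multigraph with vertices $x^i_j$ ($0\le i\le t-1$, $j\in\mathbb Z/s$) and $2st$ edges (parallel edges and loops are allowed): the horizontal edges $[x^i_j,x^i_{j+1}]$ ($0\le i\le t-1$), the vertical edges $[x^i_j,x^{i+1}_j]$ ($0\le i\le t-2$) and the diagonal edges $[x^{t-1}_j,x^0_{j+r}]$, one for each $j\in\mathbb Z/s$ in each case. In $X(2n,2,2)$ with $n=1$ the parameter $r=2$ is read modulo $s=2$. The horizontal edges form the red 2-factor, the vertical and diagonal edges form the blue 2-factor; the pair of them is the fundamental 2-factorization. Isomorphisms are isomorphisms of multigraphs. The graph $X(s,t,r)$ is the Cayley multigraph $\mathrm{Cay}(\Gamma,\{\pm\gamma_1,\pm\gamma_2\})$, where $\Gamma$ is the abelian group generated by $\gamma_1,\gamma_2$ subject to $s\gamma_1=0$ and $t\gamma_2=r\gamma_1$. The graphs $X(s,t,r)$ and $X(s',t',r')$ are called Ádám isomorphic if there is a group isomorphism $\tau:\Gamma\to\Gamma'$ between the corresponding groups (possibly followed by a translation of $\Gamma'$) that sends the list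 $\pm\gamma_1,\pm\gamma_2$ onto the list $\pm\gamma'_1,\pm\gamma'_2$. Let $s',t'\ge1$ and $0\le r'\le s'-1$. (1) Let $n\ge 1$. The graphs $X(4n,1,2n-1)$ and $X(s',t',r')$ are isomorphic if and only if either $s'=4n$, $t'=1$, $r'\in\{2n-1,2n+1\}$, or $s'=2n$, $t'=2$, $r'\in\{2,2n-2\}$. (2) Let $n\ge 1$. No isomorphism between $X(4n,1,2n-1)$ and $X(2n,2,2)$ sends the fundamental 2-factorization of the first graph onto the fundamental 2-factorization of the second. (3) Let $s,t\ge 1$ and $0\le r\le s-1$, and suppose that $X(s,t,r)$ is not isomorphic to $X(4n,1,2n-1)$ or to $X(2n,2,2)$ for any $n\ge1$. Then $X(s,t,r)$ and $X(s',t',r')$ are isomorphic if and only if they are Ádám isomorphic. With $g=\gcd(s,r)$, this happens if and only if - (case $r\ne 0$) either $s'=s$, $t'=t$, $r'\in\{r,s-r\}$, or $s'=st/g$, $t'=g$ and $r'\equiv\pm t\,u\pmod{st/g}$, where $u$ is an integer with $u\cdot (r/g)\equiv 1\pmod{s/g}$; - (case $r=0$) either $s'=s$, $t'=t$, $r'=0$,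 or $s'=t$, $t'=s$, $r'\equiv 0\pmod t$. Moreover, put $d_1=\gcd(s,t,r)$. If $r\neq0$ and $k$ is any integer with $0<k<st/d_1$, $\gcd(k,t)=1$ and $k\equiv r/d_1\pmod{s/d_1}$, then in the case $r\ne0$ the congruence for $r'$ can be replaced by $r'\equiv\pm t\,(kd_1/g)^{-1}\pmod{st/g}$, with the inverse taken modulo $st/g$. -/

import Mathlib

namespace Xstr

/-! ### Multigraphs and their isomorphisms -/

/-- An isomorphism of multigraphs: a bijection of the vertices and a bijection of the edges that
respect incidence (so multiplicities of parallel edges and loops are respected). -/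
structure MultiIso {α β α' β' : Type*} (G : Graph α β) (H : Graph α' β') where
  /-- the bijection between the vertices -/
  vertexEquiv : G.vertexSet ≃ H.vertexSet
  /-- the bijection between the edges -/
  edgeEquiv : G.edgeSet ≃ H.edgeSet
  /-- ends of edges are respected -/
  isLink_iff : ∀ (e : G.edgeSet) (x y : G.vertexSet),
    G.IsLink e x y ↔ H.IsLink (edgeEquiv e) (vertexEquiv x) (vertexEquiv y)

/-- Two multigraphs are isomorphic. -/
def Isomorphic {α β α' β' : Type*} (G : Graph α β) (H : Graph α' β') : Prop :=
  Nonempty (MultiIso G H)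

/-- The image of a set of edges under an isomorphism of multigraphs. -/
def MultiIso.edgeImage {α β α' β' : Type*} {G : Graph α β} {H : Graph α' β'}
    (φ : MultiIso G H) (F : Set β) : Set β' :=
  {e' | ∃ e : G.edgeSet, (e : β) ∈ F ∧ (φ.edgeEquiv e : β') = e'}

/-! ### The graphs `X(s, t, r)` -/

/-- Vertices of `X(s, t, r)`: the pair `(i, j)` is the vertex `x^i_j`. -/
abbrev Vert (s t : ℕ) : Type := Fin t × ZMod s

/-- Edges of `X(s, t, r)`: `inl (i, j)` is the horizontal edge that starts at `x^i_j`, and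
`inr (i, j)` is the vertical or diagonal edge that starts at `x^i_j`. -/
abbrev Edge (s t : ℕ) : Type := Vert s t ⊕ Vert s t

/-- The upper neighbour of a vertex: `x^{i+1}_j` for `i < t - 1`, and `x^0_{j+r}` for
`i = t - 1`. -/
def up (s t r : ℕ) (v : Vert s t) : Vert s t :=
  if h : (v.1 : ℕ) + 1 < t then (⟨v.1 + 1, h⟩, v.2)
  else (⟨0, v.1.pos⟩, v.2 + (r : ZMod s))

/-- The unordered pair of ends of an edge of `X(s, t, r)`: a horizontal edge is
`[x^i_j, x^i_{j+1}]`, a vertical edge is `[x^i_j, x^{i+1}_j]` and a diagonal edge is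
`[x^{t-1}_j, x^0_{j+r}]`. -/
def ends (s t r : ℕ) : Edge s t → Sym2 (Vert s t)
  | Sum.inl v => s(v, (v.1, v.2 + 1))
  | Sum.inr v => s(v, up s t r v)

/-- The multigraph `X(s, t, r)`, with `2 s t` edges (it may have parallel edges and loops). -/
def X (s t r : ℕ) : Graph (Vert s t) (Edge s t) where
  vertexSet := Set.univ
  edgeSet := Set.univ
  IsLink e x y := ends s t r e = s(x, y)
  isLink_symm := fun _ _ => ⟨fun _ _ h => h.trans Sym2.eq_swap⟩
  eq_or_eq_of_isLink_of_isLink := by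
    intro e x y v w h1 h2
    have h := h1.symm.trans h2
    rcases Sym2.eq_iff.mp h with h | h
    · exact Or.inl h.1
    · exact Or.inr h.1
  edge_mem_iff_exists_isLink := by
    intro e
    refine ⟨fun _ => ?_, fun _ => Set.mem_univ e⟩
    cases e with
    | inl v => exact ⟨_, _, rfl⟩
    | inr v => exact ⟨_, _, rfl⟩
  left_mem_of_isLink := fun _ x _ _ => Set.mem_univ x

/-- The red 2-factor of `X(s, t, r)`: the horizontal edges. -/
def red (s t : ℕ) : Set (Edge s t) := Set.range Sum.inl

/-- The blue 2-factor of `X(s, t, r)`: the vertical and diagonal edges. -/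
def blue (s t : ℕ) : Set (Edge s t) := Set.range Sum.inr

/-- The fundamental 2-factorization of `X(s, t, r)`. -/
def fundamental (s t : ℕ) : Set (Set (Edge s t)) := {red s t, blue s t}

/-- The isomorphism sends the fundamental 2-factorization onto the fundamental
2-factorization (the two colours may be interchanged). -/
def MultiIso.PreservesFundamental {s t r s' t' r' : ℕ} (φ : MultiIso (X s t r) (X s' t' r')) :
    Prop :=
  φ.edgeImage '' fundamental s t = fundamental s' t'

/-! ### Cayley representation and Ádám isomorphisms -/

/-- The relations `s γ₁ = 0` and `t γ₂ = r γ₁`, written in the free abelian group `ℤ × ℤ` with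
basis `γ₁ = (1, 0)`, `γ₂ = (0, 1)`. -/
def relations (s t r : ℕ) : AddSubgroup (ℤ × ℤ) :=
  AddSubgroup.closure {((s : ℤ), 0), (-(r : ℤ), (t : ℤ))}

/-- The abelian group `Γ` generated by `γ₁, γ₂` subject to `s γ₁ = 0` and `t γ₂ = r γ₁`. For
`s, t ≥ 1` it has order `s t`, the element `γ₁` has order `s`, and `X(s, t, r)` is the Cayley
multigraph of `Γ` and the list `±γ₁, ±γ₂`, where `x^i_j` is the element `j γ₁ + i γ₂`. Every
representation of `X(s, t, r)` as a Cayley multigraph `Cay(Γ, {±γ₁, ±γ₂})` with `Γ` an abelian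
group generated by `γ₁, γ₂`, `o(γ₁) = s`, `|Γ| = s t`, `t γ₂ = r γ₁` is isomorphic to this one
by an isomorphism of groups that matches `γ₁` and `γ₂`. For instance `Γ = ℤ/s`, `γ₁ = 1`,
`γ₂ = r` for `t = 1`, and `Γ = ℤ/s × ℤ/t`, `γ₁ = (1, 0)`, `γ₂ = (0, 1)` for `r = 0`. -/
abbrev CayGroup (s t r : ℕ) : Type := (ℤ × ℤ) ⧸ relations s t r

/-- The generator `γ₁` (its edges are the horizontal edges). -/
def gen₁ (s t r : ℕ) : CayGroup s t r := QuotientAddGroup.mk ((1 : ℤ), (0 : ℤ))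

/-- The generator `γ₂` (its edges are the vertical and diagonal edges). -/
def gen₂ (s t r : ℕ) : CayGroup s t r := QuotientAddGroup.mk ((0 : ℤ), (1 : ℤ))

/-- The list `±γ₁, ±γ₂`, with multiplicities. -/
def connectionList {Γ : Type*} [AddCommGroup Γ] (γ₁ γ₂ : Γ) : Multiset Γ :=
  {γ₁, -γ₁, γ₂, -γ₂}

/-- `f` is an Ádám isomorphism from `Cay(Γ, S)` to `Cay(Γ', S')`: a group isomorphism that sends
`S` onto `S'`, followed by a translation of `Γ'`. -/
def IsAdamIso {Γ Γ' : Type*} [AddCommGroup Γ] [AddCommGroup Γ'] (S : Multiset Γ)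
    (S' : Multiset Γ') (f : Γ → Γ') : Prop :=
  ∃ (τ : Γ ≃+ Γ') (σ : Γ'), S.map τ = S' ∧ ∀ x, f x = σ + τ x

/-- The graphs `X(s, t, r)` and `X(s', t', r')` are Ádám isomorphic. -/
def AdamIsomorphic (s t r s' t' r' : ℕ) : Prop :=
  ∃ f : CayGroup s t r → CayGroup s' t' r',
    IsAdamIso (connectionList (gen₁ s t r) (gen₂ s t r))
      (connectionList (gen₁ s' t' r') (gen₂ s' t' r')) f

/-! ### The conditions on the parameters -/

/-- The condition on the parameters for `X(s, t, r)` and `X(s', t', r')` to be Ádám isomorphic.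
For `r ≠ 0`, with `g = gcd(s, r)`: either `s' = s`, `t' = t`, `r' ∈ {r, s - r}`, or
`s' = s t / g`, `t' = g`, `r' ≡ ± t u (mod s t / g)` where `u` is an inverse of `r / g`
modulo `s / g` (the class of `t u` modulo `s t / g` does not depend on the choice of `u`).
For `r = 0`: either `s' = s`, `t' = t`, `r' = 0`, or `s' = t`, `t' = s`, `r' ≡ 0 (mod t)`. -/
def AdamParams (s t r s' t' r' : ℕ) : Prop :=
  (r ≠ 0 ∧
    ((s' = s ∧ t' = t ∧ (r' = r ∨ r' = s - r)) ∨
      (s' = s * t / s.gcd r ∧ t' = s.gcd r ∧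
        ∃ u : ℤ, u * ((r / s.gcd r : ℕ) : ℤ) ≡ 1 [ZMOD ((s / s.gcd r : ℕ) : ℤ)] ∧
          ((r' : ℤ) ≡ t * u [ZMOD ((s * t / s.gcd r : ℕ) : ℤ)] ∨
            (r' : ℤ) ≡ -(t * u) [ZMOD ((s * t / s.gcd r : ℕ) : ℤ)])))) ∨
  (r = 0 ∧
    ((s' = s ∧ t' = t ∧ r' = 0) ∨ (s' = t ∧ t' = s ∧ r' ≡ 0 [MOD t])))

/-- The greatest common divisor of `s`, `t`, `r`. -/
def d₁ (s t r : ℕ) : ℕ := (s.gcd t).gcd r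

/-- `k` is an auxiliary integer for `(s, t, r)`: `0 < k < s t / d₁`, `gcd(k, t) = 1` and
`k ≡ r / d₁ (mod s / d₁)`. -/
def IsAux (s t r k : ℕ) : Prop :=
  0 < k ∧ k < s * t / d₁ s t r ∧ k.gcd t = 1 ∧ k ≡ r / d₁ s t r [MOD (s / d₁ s t r)]

/-- The condition on the parameters for `r ≠ 0`, written with an auxiliary integer `k`: either
`s' = s`, `t' = t`, `r' ∈ {r, s - r}`, or `s' = s t / g`, `t' = g` and
`r' ≡ ± t (k d₁ / g)⁻¹ (mod s t / g)`, where `g = gcd(s, r)`. -/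
def AdamParamsAux (s t r k s' t' r' : ℕ) : Prop :=
  (s' = s ∧ t' = t ∧ (r' = r ∨ r' = s - r)) ∨
    (s' = s * t / s.gcd r ∧ t' = s.gcd r ∧
      ∃ u : ZMod (s * t / s.gcd r),
        u * ((k * d₁ s t r / s.gcd r : ℕ) : ZMod (s * t / s.gcd r)) = 1 ∧
          ((r' : ZMod (s * t / s.gcd r)) = t * u ∨ (r' : ZMod (s * t / s.gcd r)) = -(t * u)))

end Xstr

/-!
The graph `X(s, t, r)` is a Cayley multigraph of the finite abelian group `Γ = CayGroup s t r`
with connection list `±a, ±b`, where `a = γ₁` and `b = γ₂` (`isomorphic_iff`). A graph isomorphism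
is then a bijection `f : Γ ≃ Γ'` for which `f y - f x` has the same multiplicity in the list `±a',
±b'` as `y - x` has in the list `±a, ±b`.

The exceptional pairs `(a, b)` are the *twisted* ones, with `2a = ±2b` and `a ≠ ±b` for the same
sign. They are characterized by a nonzero translation that leaves the connection list invariant,
so an isomorphism respects them (`IsCayleyIso.twisted`). The graph of a twisted pair is the
blow-up of a cycle of length `m = |Γ| / 2` in which each vertex is doubled, so it depends on `|Γ|`
only (`exists_isCayleyIso_of_twisted`). For odd `m` the pair is determined by `|Γ|` up to a group
isomorphism (`Twisted.adam_of_odd`). For `m = 2n` the twisted pairs are exactly the parameters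
listed for `X(4n, 1, 2n - 1)` (`twisted_iff`).

For pairs that are not twisted, every graph isomorphism yields an Ádám isomorphism
(`adam_of_not_twisted`). If `a = ±b` the group is cyclic and there is nothing to choose. If one of
`a`, `b` has order at most two, the multiplicities distinguish the two directions. Otherwise the
pair is *ordinary*: `2a ≠ 0`, `2b ≠ 0` and `2a ≠ ±2b` (`Ordinary`). Then the argument counts walks
of length two (`walk`), a number that isomorphisms preserve. Modulo two only the four steps `±2a`,
`±2b` count, so two neighbours of a vertex with an odd number of walks between them are opposite,
unless `b = ±3a` or `a = ±3b`. These last pairs are recognized by the number of walks being three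
somewhere, and then the group is again cyclic. So `f` maps opposite neighbours to opposite
neighbours, and a comparison of the two sides of a square `x, x + a, x + a + b, x + b` shows that
`f` is affine (`adam_of_locally_affine`). If `4a = 4b = 0` no number of walks is odd, but then the
group is `ℤ/4 × ℤ/4` with basis `a, b`.

The conditions on the parameters are read off from the relations: `i a + j b = 0` holds if and
only if `j = t n` and `s ∣ i + r n` for some `n` (`rel_iff`), and interchanging the two generators
turns `(s, t, r)` into `(s t / g, g, t u)` (`rel_swap`). Finally, in `X(4n, 1, 2n - 1)` both the
red and the blue edges form a connected graph, whereas the red edges of `X(2n, 2, 2)` do not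
(`not_preservesFundamental`).
-/

namespace Xstr

section CayleyMultigraphs

variable {Γ Γ' : Type*} [AddCommGroup Γ] [AddCommGroup Γ']

/-! ### Cayley multigraphs of abelian groups with two generators -/

open Classical in
/-- The multiplicity of `d` in the connection list `±a, ±b`. For `x ≠ y` it is the number of edges
between `x` and `y` in the Cayley multigraph when `d = y - x`; a loop counts twice. -/
noncomputable def mult (a b d : Γ) : ℕ := (connectionList a b).count d

open Classical in
theorem mult_eq (a b d : Γ) : mult a b d = (if d = a then 1 else 0) + (if d = -a then 1 else 0) +
    (if d = b then 1 else 0) + (if d = -b then 1 else 0) := by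
  simp only [mult, connectionList, Multiset.insert_eq_cons, Multiset.count_cons,
    Multiset.count_singleton]
  ring

/-- The pair `a, b` generates the abelian group. -/
def Generates (a b : Γ) : Prop := ∀ x, ∃ i j : ℤ, x = i • a + j • b

/-- Some group isomorphism takes the list `±a, ±b` to the list `±a', ±b'`. The translation in the
notion of an Ádám isomorphism is irrelevant for existence. -/
def Adam (a b : Γ) (a' b' : Γ') : Prop :=
  ∃ τ : Γ ≃+ Γ', (connectionList a b).map τ = connectionList a' b'

/-- The bijection `f` is an isomorphism from the Cayley multigraph of `±a, ±b` to that of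
`±a', ±b'`. -/
def IsCayleyIso (a b : Γ) (a' b' : Γ') (f : Γ ≃ Γ') : Prop :=
  ∀ x y, mult a' b' (f y - f x) = mult a b (y - x)

/-- For one of the two signs, `a` and `±b` differ by an element of order two. -/
def Twisted (a b : Γ) : Prop := (a ≠ b ∧ a + a = b + b) ∨ (a ≠ -b ∧ a + a = -(b + b))

/-! ### Signs and order of the generators -/

theorem connectionList_swap (a b : Γ) : connectionList a b = connectionList b a := by
  simp only [connectionList, Multiset.insert_eq_cons, ← Multiset.singleton_add]
  abel

theorem connectionList_neg (a b : Γ) : connectionList a (-b) = connectionList a b := by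
  simp only [connectionList, Multiset.insert_eq_cons, ← Multiset.singleton_add, neg_neg]
  abel

theorem mult_congr {a b a₁ b₁ : Γ} (h : connectionList a b = connectionList a₁ b₁) (d : Γ) :
    mult a b d = mult a₁ b₁ d := by
  simp only [mult, h]

theorem mult_pos_iff (a b d : Γ) : 0 < mult a b d ↔ d = a ∨ d = -a ∨ d = b ∨ d = -b := by
  classical
  simp [mult, connectionList, Multiset.count_pos]

theorem Generates.swap {a b : Γ} (h : Generates a b) : Generates b a := fun x => by
  obtain ⟨i, j, rfl⟩ := h x
  exact ⟨j, i, add_comm _ _⟩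

theorem Generates.neg {a b : Γ} (h : Generates a b) : Generates a (-b) := fun x => by
  obtain ⟨i, j, rfl⟩ := h x
  exact ⟨i, -j, by simp⟩

/-! ### Twisted pairs and invariant translations -/

theorem twisted_neg_iff (a b : Γ) : Twisted a (-b) ↔ Twisted a b := by
  simp only [Twisted, neg_neg, ← neg_add]
  exact or_comm

theorem Twisted.swap {a b : Γ} (h : Twisted a b) : Twisted b a :=
  h.imp (fun ⟨h0, h⟩ => ⟨h0.symm, h.symm⟩)
    fun ⟨h0, h⟩ => ⟨fun e => h0 (by rw [e, neg_neg]), by rw [h, neg_neg]⟩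

theorem twisted_of_shift_sub {a b : Γ} (hab : a ≠ b)
    (h : ∀ d, mult a b (d + (b - a)) = mult a b d) : Twisted a b := by
  classical
  have hpos : ∀ d, 0 < mult a b d → 0 < mult a b (d + (b - a)) := fun d hd => by rwa [h]
  -- the element `2b - a` to which `b` is moved lies in the list again, with the multiplicity of `a`
  have h1 := h a
  have h2 := hpos b ((mult_pos_iff _ _ _).2 (by simp))
  have h3 := hpos (-a) ((mult_pos_iff _ _ _).2 (by simp))
  rw [mult_pos_iff] at h2 h3
  rw [add_sub_cancel] at h1
  rcases h2 with h2 | h2 | h2 | h2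
  · exact Or.inl ⟨hab, by rw [← sub_eq_zero] at h2 ⊢; rw [← neg_eq_zero, ← h2]; abel⟩
  · have hb : b = -b := by rw [← sub_eq_zero] at h2 ⊢; rw [← h2]; abel
    have ha : a = -a := by
      by_contra ha
      have hab' : a ≠ -b := by rwa [← hb]
      have hba : b ≠ -a := fun h => hab' (by rw [h, neg_neg])
      simp only [mult_eq, ← hb, if_neg ha, if_neg hab, if_neg hab.symm, if_neg hba] at h1
      simp at h1
    left
    exact ⟨hab, by rw [← sub_eq_zero, sub_eq_add_neg, neg_add, ← ha.symm, ← hb]; grind⟩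
  · exact absurd (by grind) hab
  · obtain rfl : a = b + b + b := by grind
    have hb : b + b ≠ 0 := fun h0 => hab (by rw [h0, zero_add])
    have key : b + b + b + b = 0 → Twisted (b + b + b) b := fun h4 =>
      Or.inl ⟨hab, by rw [← sub_eq_zero, ← h4]; abel⟩
    rcases h3 with h3 | h3 | h3 | h3
    · by_cases h4 : b + b + b + b = 0
      · exact key h4
      · exact Or.inr ⟨fun h5 => h4 (by rw [h5]; abel), by grind⟩
    · exact absurd (by grind) hb
    · have h6 : b + b + b = -(b + b + b) := by grind
      have h4 : b + b + b ≠ -b := fun h4 =>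
        hb (by linear_combination (norm := abel) h6 - h4)
      have h2' : b ≠ -b := fun h2 => hb (by linear_combination (norm := abel) h2)
      simp only [mult_eq, ← h6, if_neg hab, if_neg h4, if_neg h2', if_neg hab.symm] at h1
      simp at h1
    · exact key (by grind)

/-- A nonzero translation that leaves the connection list invariant exists only for twisted
pairs. The proof looks at the element of the list that `a` is moved to. -/
theorem twisted_of_shift {a b δ : Γ} (hδ : δ ≠ 0)
    (h : ∀ d, mult a b (d + δ) = mult a b d) : Twisted a b := by
  have hpos : ∀ d, 0 < mult a b d → 0 < mult a b (d + δ) := fun d hd => by rwa [h]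
  have key : a + δ = b → Twisted a b := fun h1 => by
    obtain rfl : δ = b - a := by rw [← h1]; abel
    exact twisted_of_shift_sub (fun h0 => hδ (by rw [h0, sub_self])) h
  have key' : a + δ = -b → Twisted a b := fun h1 => by
    obtain rfl : δ = -b - a := by rw [← h1]; abel
    refine (twisted_neg_iff a b).1 (twisted_of_shift_sub (fun h0 => hδ (by rw [← h0, sub_self])) ?_)
    intro d
    rw [mult_congr (connectionList_neg a b), mult_congr (connectionList_neg a b), h]
  rcases (mult_pos_iff _ _ _).1 (hpos a ((mult_pos_iff _ _ _).2 (by simp))) with h1 | h1 | h1 | h1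
  · exact absurd (by simpa using h1) hδ
  · obtain rfl : δ = -a - a := by rw [← h1]; abel
    have hne : a ≠ -a := fun h6 => hδ (by rw [← h6, sub_self])
    have heq : a = b → Twisted a b := fun h5 => by
      subst h5
      refine Or.inr ⟨hne, ?_⟩
      have h3 := (mult_pos_iff _ _ _).1 (hpos (-a) ((mult_pos_iff _ _ _).2 (by simp)))
      replace h3 : -a + (-a - a) = a ∨ -a + (-a - a) = -a := by tauto
      rcases h3 with h3 | h3
      · linear_combination (norm := abel) -h3
      · exact absurd (by linear_combination (norm := abel) -h3) hne
    rcases (mult_pos_iff _ _ _).1 (hpos b ((mult_pos_iff _ _ _).2 (by simp)))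
      with h2 | h2 | h2 | h2
    · obtain rfl : b = a + a + a := by linear_combination (norm := abel) h2
      refine Twisted.swap (twisted_of_shift_sub (fun h5 => ?_) fun d => ?_)
      · exact hδ (by linear_combination (norm := abel) -h5)
      · rw [mult_congr (connectionList_swap _ a), mult_congr (connectionList_swap _ a),
          show a - (a + a + a) = -a - a by abel, h]
    · exact heq (by linear_combination (norm := abel) -h2)
    · exact absurd (by simpa using h2) hδ
    · by_cases h5 : a = b
      · exact heq h5
      · exact Or.inl ⟨h5, by linear_combination (norm := abel) -h2⟩
  · exact key h1
  · exact key' h1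

theorem Twisted.exists_shift {a b : Γ} (h : Twisted a b) :
    ∃ δ : Γ, δ ≠ 0 ∧ ∀ d, mult a b (d + δ) = mult a b d := by
  classical
  wlog hs : a ≠ b ∧ a + a = b + b generalizing b
  · obtain ⟨δ, h0, h1⟩ := this ((twisted_neg_iff a b).2 h) (by
      rcases h with h | h
      · exact absurd h hs
      · simpa [neg_add_rev] using h)
    exact ⟨δ, h0, fun d => by simpa only [mult_congr (connectionList_neg a b)] using h1 d⟩
  obtain ⟨h0, h⟩ := hs
  refine ⟨b - a, sub_ne_zero.2 h0.symm, fun d => ?_⟩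
  have e1 : d + (b - a) = b ↔ d = a :=
    ⟨fun e => by linear_combination (norm := abel) e, fun e => by
      linear_combination (norm := abel) e⟩
  have e2 : d + (b - a) = a ↔ d = b :=
    ⟨fun e => by linear_combination (norm := abel) e + h, fun e => by
      linear_combination (norm := abel) e - h⟩
  have e3 : d + (b - a) = -a ↔ d = -b :=
    ⟨fun e => by linear_combination (norm := abel) e, fun e => by
      linear_combination (norm := abel) e⟩
  have e4 : d + (b - a) = -b ↔ d = -a :=
    ⟨fun e => by linear_combination (norm := abel) e + h, fun e => by
      linear_combination (norm := abel) e - h⟩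
  simp only [mult_eq, e1, e2, e3, e4]
  ring

/-! ### Graph isomorphisms -/

theorem IsCayleyIso.symm {a b : Γ} {a' b' : Γ'} {f : Γ ≃ Γ'} (h : IsCayleyIso a b a' b' f) :
    IsCayleyIso a' b' a b f.symm := fun x y => by
  simpa using (h (f.symm x) (f.symm y)).symm

theorem IsCayleyIso.twisted {a b : Γ} {a' b' : Γ'} {f : Γ ≃ Γ'} (h : IsCayleyIso a b a' b' f)
    (ht : Twisted a b) : Twisted a' b' := by
  obtain ⟨δ, h0, hδ⟩ := ht.exists_shift
  -- `f` carries the translation by `δ` to a translation that leaves the second list invariant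
  refine twisted_of_shift (δ := f 0 - f (-δ)) (fun h1 => h0 ?_) fun d => ?_
  · simpa using f.injective (sub_eq_zero.mp h1)
  · have h1 := h (-δ) (f.symm (d + f 0))
    have h2 := h 0 (f.symm (d + f 0))
    rw [Equiv.apply_symm_apply] at h1 h2
    rw [show d + (f 0 - f (-δ)) = d + f 0 - f (-δ) by abel, h1,
      show mult a' b' d = mult a' b' (d + f 0 - f 0) by rw [add_sub_cancel_right], h2,
      sub_neg_eq_add, sub_zero, hδ]

theorem Adam.symm {a b : Γ} {a' b' : Γ'} (h : Adam a b a' b') : Adam a' b' a b := by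
  obtain ⟨τ, h⟩ := h
  exact ⟨τ.symm, by simp [← h]⟩

theorem Adam.congr {a b a₁ b₁ : Γ} {a' b' a₁' b₁' : Γ'} (h : Adam a b a' b')
    (e : connectionList a b = connectionList a₁ b₁)
    (e' : connectionList a' b' = connectionList a₁' b₁') : Adam a₁ b₁ a₁' b₁' := by
  obtain ⟨τ, h⟩ := h
  exact ⟨τ, by rw [← e, ← e', h]⟩

theorem IsCayleyIso.congr {a b a₁ b₁ : Γ} {a' b' a₁' b₁' : Γ'} {f : Γ ≃ Γ'}
    (h : IsCayleyIso a b a' b' f)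
    (e : connectionList a b = connectionList a₁ b₁)
    (e' : connectionList a' b' = connectionList a₁' b₁') : IsCayleyIso a₁ b₁ a₁' b₁' f :=
  fun x y => by rw [← mult_congr e', ← mult_congr e, h]

/-! ### Group isomorphisms from relations -/

/-- Two finite abelian groups of the same order, with generating pairs such that each relation
of the first pair holds for the second, are isomorphic by a map that matches the pairs. -/
theorem exists_addEquiv_of_relations [Finite Γ] {a b : Γ} {a' b' : Γ'} (hg : Generates a b)
    (hg' : Generates a' b') (hc : Nat.card Γ = Nat.card Γ')
    (h : ∀ i j : ℤ, i • a + j • b = 0 → i • a' + j • b' = 0) :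
    ∃ τ : Γ ≃+ Γ', τ a = a' ∧ τ b = b' := by
  let φ : ℤ × ℤ →+ Γ := (zmultiplesHom Γ a).coprod (zmultiplesHom Γ b)
  let φ' : ℤ × ℤ →+ Γ' := (zmultiplesHom Γ' a').coprod (zmultiplesHom Γ' b')
  have hφ : Function.Surjective φ := fun x => by
    obtain ⟨i, j, rfl⟩ := hg x
    exact ⟨(i, j), by simp [φ]⟩
  let ψ : Γ →+ Γ' := φ.liftOfSurjective hφ ⟨φ', fun x hx => by
    simpa [φ'] using h x.1 x.2 (by simpa [φ] using hx)⟩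
  have hψ : ∀ i j : ℤ, ψ (i • a + j • b) = i • a' + j • b' := fun i j => by
    have := φ.liftOfRightInverse_comp_apply _ (Function.rightInverse_surjInv hφ) ⟨φ', fun x hx => by
      simpa [φ'] using h x.1 x.2 (by simpa [φ] using hx)⟩ (i, j)
    simpa [φ, φ'] using this
  have hb : Function.Bijective ψ := by
    refine Function.Surjective.bijective_of_nat_card_le (fun y => ?_) hc.le
    obtain ⟨i, j, rfl⟩ := hg' y
    exact ⟨_, hψ i j⟩
  refine ⟨AddEquiv.ofBijective ψ hb, ?_, ?_⟩
  · simpa using hψ 1 0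
  · simpa using hψ 0 1

theorem adam_of_addEquiv {a b : Γ} {a' b' : Γ'} (τ : Γ ≃+ Γ') (ha : τ a = a') (hb : τ b = b') :
    Adam a b a' b' := ⟨τ, by simp [connectionList, ha, hb]⟩

theorem exists_addEquiv_of_cyclic [Finite Γ] {g : Γ} {g' : Γ'} (hg : ∀ x, ∃ i : ℤ, x = i • g)
    (hg' : ∀ x, ∃ i : ℤ, x = i • g') (hc : Nat.card Γ = Nat.card Γ') :
    ∃ τ : Γ ≃+ Γ', τ g = g' := by
  have ho : addOrderOf g' = addOrderOf g := by
    rw [addOrderOf_eq_card_of_forall_mem_zmultiples, addOrderOf_eq_card_of_forall_mem_zmultiples,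
      hc] <;> intro x
    · obtain ⟨i, rfl⟩ := hg x
      exact ⟨i, rfl⟩
    · obtain ⟨i, rfl⟩ := hg' x
      exact ⟨i, rfl⟩
  obtain ⟨τ, h, -⟩ := exists_addEquiv_of_relations (a := g) (b := 0) (a' := g') (b' := 0)
    (fun x => by
      obtain ⟨i, rfl⟩ := hg x
      exact ⟨i, 0, by simp⟩)
    (fun x => by
      obtain ⟨i, rfl⟩ := hg' x
      exact ⟨i, 0, by simp⟩) hc (fun i j h => by
      simp only [smul_zero, add_zero] at h ⊢
      rwa [← addOrderOf_dvd_iff_zsmul_eq_zero, ho, addOrderOf_dvd_iff_zsmul_eq_zero])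
  exact ⟨τ, h⟩

theorem adam_of_cyclic [Finite Γ] {a b g : Γ} {a' b' g' : Γ'} (hg : ∀ x, ∃ i : ℤ, x = i • g)
    (hg' : ∀ x, ∃ i : ℤ, x = i • g') (hc : Nat.card Γ = Nat.card Γ') (k : ℤ)
    (h : connectionList g (k • g) = connectionList a b)
    (h' : connectionList g' (k • g') = connectionList a' b') : Adam a b a' b' := by
  obtain ⟨τ, hτ⟩ := exists_addEquiv_of_cyclic hg hg' hc
  exact (adam_of_addEquiv τ hτ (by simp [hτ])).congr h h'

/-! ### Affine maps -/

theorem map_add_zsmul {f : Γ → Γ'} {a : Γ} {A : Γ'} (h : ∀ x, f (x + a) = f x + A) (x : Γ)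
    (i : ℤ) : f (x + i • a) = f x + i • A := by
  induction i with
  | zero => simp
  | succ i ih => rw [add_zsmul, one_zsmul, ← add_assoc, h, ih, add_zsmul, one_zsmul, add_assoc]
  | pred i ih =>
    have e := h (x + (-(i : ℤ) - 1) • a)
    rw [show x + (-(i : ℤ) - 1) • a + a = x + -(i : ℤ) • a by rw [sub_zsmul, one_zsmul]; abel,
      ih] at e
    rw [← add_left_inj A, ← e, sub_zsmul, one_zsmul]
    abel

/-- The increments `A`, `B` of `f` in the directions `a`, `b` are constant if each is constant
along its own direction and changes at most its sign along the other one. Walking around the square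
`x, x + a, x + a + b, x + b` in both ways excludes a change of sign. -/
theorem adam_of_locally_affine [Finite Γ] {a b : Γ} {a' b' : Γ'} (hg : Generates a b) (f : Γ ≃ Γ')
    (A B : Γ → Γ') (hA : ∀ x, f (x + a) = f x + A x) (hB : ∀ x, f (x + b) = f x + B x)
    (h0 : connectionList (A 0) (B 0) = connectionList a' b')
    (h1 : ∀ x, A (x + a) = A x) (h2 : ∀ x, B (x + b) = B x)
    (h3 : ∀ x, A (x + b) = A x ∨ A (x + b) = -A x)
    (h4 : ∀ x, B (x + a) = B x ∨ B (x + a) = -B x)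
    (h5 : ∀ x, B x + B x ≠ 0) (h6 : ∀ x, A x + A x ≠ B x + B x) : Adam a b a' b' := by
  -- the two ways around the square
  have hsq : ∀ x, A x + B (x + a) = B x + A (x + b) := fun x => by
    have e1 := hB (x + a)
    have e2 := hA (x + b)
    rw [hA] at e1
    rw [hB, add_right_comm x b a, e1] at e2
    linear_combination (norm := abel) e2
  have hBa : ∀ x, B (x + a) = B x := fun x => by
    refine (h4 x).resolve_right fun e => ?_
    have e1 := hsq x
    rcases h3 x with e3 | e3
    · exact h5 x (by linear_combination (norm := abel) e - e1 - e3)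
    · exact h6 x (by linear_combination (norm := abel) e1 - e + e3)
  have hAb : ∀ x, A (x + b) = A x := fun x => by
    linear_combination (norm := abel) hBa x - hsq x
  have hA0 : ∀ x, A x = A 0 := fun x => by
    obtain ⟨i, j, rfl⟩ := hg x
    rw [(Function.Periodic.zsmul (f := A) hAb j) (i • a), ← zero_add (i • a),
      (Function.Periodic.zsmul (f := A) h1 i) 0]
  have hB0 : ∀ x, B x = B 0 := fun x => by
    obtain ⟨i, j, rfl⟩ := hg x
    rw [(Function.Periodic.zsmul (f := B) h2 j) (i • a), ← zero_add (i • a),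
      (Function.Periodic.zsmul (f := B) hBa i) 0]
  have hf : ∀ i j : ℤ, f (i • a + j • b) = f 0 + (i • A 0 + j • B 0) := fun i j => by
    rw [map_add_zsmul (f := f) (A := B 0) (fun x => by rw [hB, hB0]), ← zero_add (i • a),
      map_add_zsmul (f := f) (A := A 0) (fun x => by rw [hA, hA0]), add_assoc]
  -- the constant increments satisfy every relation of `a, b`, because `f` is well defined
  obtain ⟨τ, ha, hb⟩ := exists_addEquiv_of_relations (a' := A 0) (b' := B 0) hg (fun y => by
    obtain ⟨i, j, h⟩ := hg (f.symm (y + f 0))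
    refine ⟨i, j, ?_⟩
    rw [← add_right_inj (f 0), ← hf, ← h, Equiv.apply_symm_apply, add_comm])
    (Nat.card_congr f) fun i j h => by simpa [h] using hf i j
  exact (adam_of_addEquiv τ ha hb).congr rfl h0

/-! ### Walks of length two -/

/-- The number of walks of length two between two vertices with difference `d`. -/
noncomputable def walk (a b d : Γ) : ℕ :=
  mult a b (d - a) + mult a b (d - -a) + mult a b (d - b) + mult a b (d - -b)

theorem walk_eq_sum [Fintype Γ] (a b d : Γ) :
    walk a b d = ∑ z, mult a b z * mult a b (d - z) := by
  classical
  have h : ∀ g : Γ → ℕ, ∑ z, mult a b z * g z = g a + g (-a) + g b + g (-b) := fun g => by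
    simp [mult_eq, add_mul, Finset.sum_add_distrib]
  rw [h fun z => mult a b (d - z)]
  rfl

theorem IsCayleyIso.walk [Finite Γ] {a b : Γ} {a' b' : Γ'} {f : Γ ≃ Γ'}
    (h : IsCayleyIso a b a' b' f) (x y : Γ) : walk a' b' (f y - f x) = walk a b (y - x) := by
  have := Fintype.ofFinite Γ
  have := Fintype.ofEquiv Γ f
  rw [walk_eq_sum, walk_eq_sum]
  refine (Fintype.sum_equiv ((Equiv.addRight x).trans (f.trans (Equiv.subRight (f x)))) _ _
    fun z => ?_).symm
  simp only [Equiv.trans_apply, Equiv.subRight_apply, Equiv.coe_addRight, sub_sub_sub_cancel_right]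
  rw [h, h, add_sub_cancel_right, sub_sub, add_comm x z]

open Classical in
/-- The steps `±2a`, `±2b` arise in one way each, the steps `±a ± b` in two ways, and the step
`0` in four ways. -/
theorem walk_eq (a b d : Γ) : walk a b d =
    ((if d = a + a then 1 else 0) + (if d = -(a + a) then 1 else 0) +
      (if d = b + b then 1 else 0) + (if d = -(b + b) then 1 else 0)) +
    2 * ((if d = a + b then 1 else 0) + (if d = a - b then 1 else 0) +
      (if d = b - a then 1 else 0) + (if d = -a - b then 1 else 0)) +
    4 * (if d = 0 then 1 else 0) := by
  simp only [walk, mult_eq, sub_eq_iff_eq_add, neg_add_cancel, add_neg_cancel]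
  simp only [← sub_eq_add_neg, neg_add', sub_eq_neg_add b a, add_comm b a,
    neg_add_eq_sub b a, show -b - a = -a - b by abel]
  ring

/-! ### Ordinary pairs -/

/-- The elements `2a`, `2b` are nonzero and `2a ≠ ±2b`. Equivalently, the pair is not twisted and
`±a, ±b` are four distinct elements, so that the graph is simple. -/
structure Ordinary (a b : Γ) : Prop where
  double_left : a + a ≠ 0
  double_right : b + b ≠ 0
  double_ne : a + a ≠ b + b
  double_ne_neg : a + a ≠ -(b + b)

theorem Ordinary.swap {a b : Γ} (h : Ordinary a b) : Ordinary b a :=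
  ⟨h.2, h.1, h.3.symm, fun e => h.4 (by rw [e, neg_neg])⟩

theorem Ordinary.neg {a b : Γ} (h : Ordinary a b) : Ordinary a (-b) :=
  ⟨h.1, fun e => h.2 (by linear_combination (norm := abel) -e),
    fun e => h.4 (by linear_combination (norm := abel) e),
    fun e => h.3 (by linear_combination (norm := abel) e)⟩

theorem Ordinary.neg_left {a b : Γ} (h : Ordinary a b) : Ordinary (-a) b := h.swap.neg.swap

theorem connectionList_neg_left (a b : Γ) : connectionList (-a) b = connectionList a b := by
  rw [connectionList_swap, connectionList_neg, connectionList_swap]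

theorem Ordinary.ne {a b : Γ} (h : Ordinary a b) : a ≠ b := fun e => h.3 (by rw [e])

theorem Ordinary.ne_neg {a b : Γ} (h : Ordinary a b) : a ≠ -b := fun e => h.4 (by rw [e, neg_add])

theorem Ordinary.mult_le_one {a b : Γ} (h : Ordinary a b) (d : Γ) : mult a b d ≤ 1 := by
  classical
  have h1 := h.ne
  have h2 := h.ne_neg
  have h3 : a ≠ -a := fun e => h.1 (by linear_combination (norm := abel) e)
  have h4 : b ≠ -b := fun e => h.2 (by linear_combination (norm := abel) e)
  have h5 : -a ≠ b := fun e => h2 (by rw [← e, neg_neg])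
  have h6 : -a ≠ -b := fun e => h1 (neg_injective e)
  rw [mult_eq]
  split_ifs <;> simp_all

theorem two_le_mult_of_not_ordinary {a b : Γ} (h : ¬ Ordinary a b) (ht : ¬ Twisted a b) :
    ∃ d, 2 ≤ mult a b d := by
  classical
  by_contra! hc
  have ha := hc a
  have hb := hc b
  rw [mult_eq] at ha hb
  have h1 : a ≠ b := fun e => by simp [e] at ha; omega
  have h2 : a ≠ -b := fun e => by simp [e] at ha
  have h3 : a ≠ -a := fun e => by rw [if_pos rfl, if_pos e] at ha; omega
  have h4 : b ≠ -b := fun e => by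
    rw [if_pos (rfl : b = b), if_pos e] at hb; omega
  refine h ⟨fun e => h3 (by linear_combination (norm := abel) e),
    fun e => h4 (by linear_combination (norm := abel) e), fun e => ht (Or.inl ⟨h1, e⟩),
    fun e => ht (Or.inr ⟨h2, e⟩)⟩

/-- A pair that is not twisted has only even multiplicities exactly for a doubled cycle. -/
theorem even_mult_iff {a b : Γ} (ht : ¬ Twisted a b) :
    (∀ d, Even (mult a b d)) ↔ a = b ∨ a = -b := by
  classical
  refine ⟨fun h => ?_, ?_⟩
  · by_contra! hc
    obtain ⟨h1, h2⟩ := hc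
    have ha := h a
    have hb := h b
    have h2' : b ≠ -a := fun e => h2 (by rw [e, neg_neg])
    rw [mult_eq] at ha hb
    simp only [if_neg h1, if_neg h2, if_neg h1.symm, if_neg h2', if_true] at ha hb
    have h3 : a = -a := by by_contra h3; simp [h3] at ha
    have h4 : b = -b := by by_contra h4; simp [h4] at hb
    exact ht (Or.inl ⟨h1, by linear_combination (norm := abel) h3 - h4⟩)
  · have key : ∀ d, Even (mult b b d) := fun d => by
      rw [mult_eq, add_assoc (_ + _)]
      exact ⟨_, rfl⟩
    rintro (rfl | rfl) d
    · exact key d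
    · rw [mult_congr (connectionList_neg_left _ _)]
      exact key d

/-- Two elements of the connection list that are neither equal nor opposite form the same
list. -/
theorem Ordinary.complement {a b u v : Γ} (h : Ordinary a b) (hu : 0 < mult a b u)
    (hv : 0 < mult a b v) (h1 : u ≠ v) (h2 : u ≠ -v) :
    Ordinary u v ∧ connectionList u v = connectionList a b := by
  rw [mult_pos_iff] at hu hv
  have e1 := connectionList_neg_left a b
  have e2 := connectionList_neg a b
  have e3 := connectionList_swap a b
  rcases hu with rfl | rfl | rfl | rfl <;> rcases hv with rfl | rfl | rfl | rfl <;>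
    simp only [ne_eq, neg_neg, not_true_eq_false] at h1 h2
  · exact ⟨h, rfl⟩
  · exact ⟨h.neg, e2⟩
  · exact ⟨h.neg_left, e1⟩
  · exact ⟨h.neg_left.neg, by rw [connectionList_neg, e1]⟩
  · exact ⟨h.swap, e3.symm⟩
  · exact ⟨h.swap.neg, by rw [connectionList_neg, e3]⟩
  · exact ⟨h.swap.neg_left, by rw [connectionList_neg_left, e3]⟩
  · exact ⟨h.swap.neg_left.neg, by rw [connectionList_neg, connectionList_neg_left, e3]⟩

theorem Ordinary.eq_or_eq_neg {a b u v w : Γ} (h : Ordinary a b) (hu : 0 < mult a b u)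
    (hv : 0 < mult a b v) (hw : 0 < mult a b w) (h1 : u ≠ v) (h2 : u ≠ -v)
    (h3 : w ≠ v) (h4 : w ≠ -v) : w = u ∨ w = -u := by
  rw [← mult_congr (h.complement hu hv h1 h2).2, mult_pos_iff] at hw
  tauto

/-! ### Generators of which one is three times the other -/

/-- One of the two generators is, up to sign, three times the other one. -/
def ThriceRelated (a b : Γ) : Prop :=
  (b = a + a + a ∨ b = -(a + a + a)) ∨ (a = b + b + b ∨ a = -(b + b + b))

theorem ThriceRelated.swap {a b : Γ} (h : ThriceRelated a b) : ThriceRelated b a := Or.symm h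

theorem ThriceRelated.exists_generator {a b : Γ} (hg : Generates a b) (h : ThriceRelated a b) :
    ∃ g : Γ, (∀ x, ∃ i : ℤ, x = i • g) ∧ connectionList g ((3 : ℤ) • g) = connectionList a b := by
  wlog h1 : b = a + a + a ∨ b = -(a + a + a) generalizing a b
  · obtain ⟨g, h2, h3⟩ := this hg.swap h.swap (h.resolve_left h1)
    exact ⟨g, h2, by rw [h3, connectionList_swap]⟩
  refine ⟨a, fun x => ?_, ?_⟩
  · obtain ⟨i, j, rfl⟩ := hg x
    rcases h1 with rfl | rfl
    · exact ⟨i + 3 * j, by module⟩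
    · exact ⟨i - 3 * j, by module⟩
  · rcases h1 with rfl | rfl
    · congr 1; module
    · rw [connectionList_neg]; congr 1; module

theorem ThriceRelated.adam [Finite Γ] {a b : Γ} {a' b' : Γ'} (hg : Generates a b)
    (hg' : Generates a' b') (hc : Nat.card Γ = Nat.card Γ') (h : ThriceRelated a b)
    (h' : ThriceRelated a' b') : Adam a b a' b' := by
  obtain ⟨g, h1, h2⟩ := h.exists_generator hg
  obtain ⟨g', h1', h2'⟩ := h'.exists_generator hg'
  exact adam_of_cyclic h1 h1' hc 3 h2 h2'

/-! ### Parity of the number of walks -/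

open Classical in
theorem odd_walk {a b d : Γ} (hd : Odd (walk a b d)) :
    (d = a + a ∨ d = -(a + a)) ∧ a + a ≠ -(a + a) ∨
      (d = b + b ∨ d = -(b + b)) ∧ b + b ≠ -(b + b) := by
  -- if no step is unambiguous, the odd part of the count is a sum of two even terms
  rw [walk_eq, Nat.odd_add, Nat.odd_add] at hd
  by_contra! hc
  obtain ⟨h1, h2⟩ := hc
  simp only [even_two, Even.mul_right, iff_true, show Even 4 by decide] at hd
  have e1 : (d = a + a ↔ d = -(a + a)) := ⟨fun e => by rw [e, ← h1 (Or.inl e)],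
    fun e => by rw [e, h1 (Or.inr e), neg_neg, ← h1 (Or.inr e)]⟩
  have e2 : (d = b + b ↔ d = -(b + b)) := ⟨fun e => by rw [e, ← h2 (Or.inl e)],
    fun e => by rw [e, h2 (Or.inr e), neg_neg, ← h2 (Or.inr e)]⟩
  simp only [e1, e2] at hd
  rw [add_assoc (_ + _)] at hd
  exact Nat.not_odd_iff_even.2 (Even.add ⟨_, rfl⟩ ⟨_, rfl⟩) hd

open Classical in
theorem Ordinary.odd_walk_double {a b : Γ} (h : Ordinary a b) (hb : b + b ≠ -(b + b)) :
    Odd (walk a b (b + b)) := by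
  have h3 : b + b ≠ -(a + a) := fun e => h.4 (by rw [e, neg_neg])
  rw [walk_eq, if_neg h.double_ne.symm, if_neg h3, if_pos rfl, if_neg hb, if_neg h.double_right]
  exact ⟨_, add_comm 1 _⟩

open Classical in
/-- The number of walks between two vertices is three only if a step `±2a` or `±2b` coincides
with exactly one of the steps `±a ± b`. -/
theorem Ordinary.exists_walk_eq_three_iff {a b : Γ} (h : Ordinary a b) :
    (∃ d, walk a b d = 3) ↔ ThriceRelated a b := by
  constructor
  · rintro ⟨d, hd⟩
    wlog hs : (d = a + a ∨ d = -(a + a)) ∧ a + a ≠ -(a + a) generalizing a b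
    · refine (this h.swap ?_ ((odd_walk (by rw [hd]; decide)).resolve_left hs)).swap
      rw [← hd]
      simp only [walk, mult_congr (connectionList_swap b a)]
      ring
    obtain ⟨hd1, ha⟩ := hs
    have h3 : b + b ≠ -(a + a) := fun e => h.4 (by rw [e, neg_neg])
    by_contra hT
    have n1 : d ≠ a + b := by
      rintro rfl
      rcases hd1 with e | e
      · exact h.ne (by linear_combination (norm := abel) -e)
      · exact hT (Or.inl (Or.inr (by linear_combination (norm := abel) e)))
    have n2 : d ≠ a - b := by
      rintro rfl
      rcases hd1 with e | e
      · exact h.ne_neg (by linear_combination (norm := abel) -e)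
      · exact hT (Or.inl (Or.inl (by linear_combination (norm := abel) -e)))
    have n3 : d ≠ b - a := by
      rintro rfl
      rcases hd1 with e | e
      · exact hT (Or.inl (Or.inl (by linear_combination (norm := abel) e)))
      · exact h.ne_neg (by linear_combination (norm := abel) e)
    have n4 : d ≠ -a - b := by
      rintro rfl
      rcases hd1 with e | e
      · exact hT (Or.inl (Or.inr (by linear_combination (norm := abel) -e)))
      · exact h.ne (by linear_combination (norm := abel) e)
    have n0 : d ≠ 0 := by
      rintro rfl
      rcases hd1 with e | e
      · exact h.1 e.symm
      · exact h.1 (by linear_combination (norm := abel) e)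
    have n5 : d ≠ b + b := by
      rintro rfl
      rcases hd1 with e | e
      · exact h.3 e.symm
      · exact h3 e
    have n6 : d ≠ -(b + b) := by
      rintro rfl
      rcases hd1 with e | e
      · exact h.4 e.symm
      · exact h.3 (by linear_combination (norm := abel) e)
    rw [walk_eq] at hd
    simp only [n0, n1, n2, n3, n4, n5, n6, if_false] at hd
    split_ifs at hd <;> simp at hd
  · intro hT
    wlog hs : b = a + a + a generalizing a b
    · rcases hT with (hT | hT) | (hT | hT)
      · exact absurd hT hs
      · obtain ⟨d, hd⟩ := this h.neg (Or.inl (Or.inl (by rw [hT, neg_neg]))) (by rw [hT, neg_neg])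
        refine ⟨d, ?_⟩
        rw [← hd]
        simp only [walk, mult_congr (connectionList_neg a b), neg_neg]
        ring
      · obtain ⟨d, hd⟩ := this h.swap (Or.inl (Or.inl hT)) hT
        refine ⟨d, ?_⟩
        rw [← hd]
        simp only [walk, mult_congr (connectionList_swap b a)]
        ring
      · obtain ⟨d, hd⟩ := this h.swap.neg (Or.inl (Or.inl (by rw [hT, neg_neg])))
          (by rw [hT, neg_neg])
        refine ⟨d, ?_⟩
        rw [← hd]
        simp only [walk, mult_congr (connectionList_neg b a),
          mult_congr (connectionList_swap b a), neg_neg]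
        ring
    subst hs
    have m1 : a + a ≠ -(a + a) := fun e => h.ne_neg (by linear_combination (norm := abel) e)
    have m2 : a + a ≠ a + (a + a + a) := fun e => h.1 (by linear_combination (norm := abel) -e)
    have m3 : a + a ≠ a - (a + a + a) := fun e => m1 (by linear_combination (norm := abel) e)
    have m4 : a + a = a + a + a - a := by abel
    have m5 : a + a ≠ -a - (a + a + a) := fun e => h.2 (by linear_combination (norm := abel) e)
    refine ⟨a + a, ?_⟩
    rw [walk_eq, if_pos rfl, if_neg m1, if_neg h.3, if_neg h.4, if_neg m2, if_neg m3, if_pos m4,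
      if_neg m5, if_neg h.1]

theorem Ordinary.not_odd_walk_sub {a b : Γ} (h : Ordinary a b) (hT : ¬ ThriceRelated a b)
    (hd : Odd (walk a b (b - a))) : False := by
  rcases odd_walk hd with ⟨e | e, -⟩ | ⟨e | e, -⟩
  · exact hT (Or.inl (Or.inl (by linear_combination (norm := abel) e)))
  · exact h.ne_neg (by linear_combination (norm := abel) e)
  · exact h.ne_neg (by linear_combination (norm := abel) -e)
  · exact hT (Or.inr (Or.inl (by linear_combination (norm := abel) -e)))

theorem walk_congr {a b a₁ b₁ : Γ} (h : connectionList a b = connectionList a₁ b₁) [Finite Γ]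
    (d : Γ) : walk a b d = walk a₁ b₁ d := by
  have := Fintype.ofFinite Γ
  simp only [walk_eq_sum, mult_congr h]

/-- Two neighbours of a vertex that are joined by an odd number of walks are opposite. -/
theorem Ordinary.eq_neg_of_odd_walk [Finite Γ] {a b u v : Γ} (h : Ordinary a b)
    (hT : ¬ ThriceRelated a b) (hu : 0 < mult a b u) (hv : 0 < mult a b v)
    (hd : Odd (walk a b (u - v))) : u = -v := by
  by_contra h2
  have h1 : u ≠ v := by
    rintro rfl
    rw [sub_self] at hd
    rcases odd_walk hd with ⟨e | e, -⟩ | ⟨e | e, -⟩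
    · exact h.1 e.symm
    · exact h.1 (by linear_combination (norm := abel) e)
    · exact h.2 e.symm
    · exact h.2 (by linear_combination (norm := abel) e)
  obtain ⟨ho, he⟩ := h.complement hv hu (Ne.symm h1) (fun e => h2 (by rw [e, neg_neg]))
  refine ho.not_odd_walk_sub (fun hT' => hT ?_) (by rwa [walk_congr he])
  rw [← h.exists_walk_eq_three_iff]
  obtain ⟨d, hd⟩ := ho.exists_walk_eq_three_iff.2 hT'
  exact ⟨d, by rw [← walk_congr he, hd]⟩

/-! ### Isomorphisms between ordinary pairs -/

/-- If `4b ≠ 0`, the number of walks between `x + b` and `x - b` is odd, so `f` maps these two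
vertices to opposite neighbours of `f x`. The remaining two neighbours are then opposite as well. -/
theorem adam_of_ordinary_aux [Finite Γ] {a b : Γ} {a' b' : Γ'} (hg : Generates a b) {f : Γ ≃ Γ'}
    (hf : IsCayleyIso a b a' b' f) (h : Ordinary a b) (h' : Ordinary a' b')
    (hT' : ¬ ThriceRelated a' b') (hb : b + b ≠ -(b + b)) : Adam a b a' b' := by
  have := Finite.of_equiv Γ f
  have key : ∀ x d, mult a b d ≠ 0 → 0 < mult a' b' (f (x + d) - f x) := fun x d hd => by
    rw [hf, add_sub_cancel_left]; exact Nat.pos_of_ne_zero hd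
  have ha1 : mult a b a ≠ 0 := ((mult_pos_iff _ _ _).2 (by simp)).ne'
  have ha2 : mult a b (-a) ≠ 0 := ((mult_pos_iff _ _ _).2 (by simp)).ne'
  have hb1 : mult a b b ≠ 0 := ((mult_pos_iff _ _ _).2 (by simp)).ne'
  have hb2 : mult a b (-b) ≠ 0 := ((mult_pos_iff _ _ _).2 (by simp)).ne'
  have hBneg : ∀ x, f (x + b) - f x = -(f (x + -b) - f x) := fun x => by
    refine h'.eq_neg_of_odd_walk hT' (key x b hb1) (key x (-b) hb2) ?_
    rw [sub_sub_sub_cancel_right, hf.walk, add_sub_add_left_eq_sub, sub_neg_eq_add]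
    exact h.odd_walk_double hb
  have hinj : ∀ x d e, d ≠ e → f (x + d) - f x ≠ f (x + e) - f x := fun x d e hde e1 =>
    hde (add_left_cancel (f.injective (sub_left_injective e1)))
  have hAB : ∀ x, f (x + a) - f x ≠ f (x + b) - f x := fun x => hinj x _ _ h.ne
  have hAB' : ∀ x, f (x + a) - f x ≠ -(f (x + b) - f x) := fun x => by
    rw [hBneg, neg_neg]
    exact hinj x _ _ h.ne_neg
  have hABo := fun x => h'.complement (key x a ha1) (key x b hb1) (hAB x) (hAB' x)
  have hAneg : ∀ x, f (x + a) - f x = -(f (x + -a) - f x) := fun x => by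
    have h1 := h'.eq_or_eq_neg (key x a ha1) (key x b hb1) (key x (-a) ha2) (hAB x) (hAB' x)
      (hinj x _ _ h.neg_left.ne) (by
        rw [hBneg, neg_neg]; exact hinj x _ _ h.neg_left.ne_neg)
    rcases h1 with h1 | h1
    · exact absurd h1 (hinj x _ _ fun e => h.1 (by linear_combination (norm := abel) -e))
    · rw [h1, neg_neg]
  have hAA : ∀ x, f (x + a + a) - f (x + a) = f (x + a) - f x := fun x => by
    rw [hAneg, neg_sub, add_neg_cancel_right]
  have hBB : ∀ x, f (x + b + b) - f (x + b) = f (x + b) - f x := fun x => by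
    rw [hBneg, neg_sub, add_neg_cancel_right]
  refine adam_of_locally_affine hg f (fun x => f (x + a) - f x) (fun x => f (x + b) - f x)
    (fun x => (add_sub_cancel _ _).symm) (fun x => (add_sub_cancel _ _).symm)
    (hABo 0).2 hAA hBB (fun x => ?_) (fun x => ?_) (fun x => (hABo x).1.2) (fun x => (hABo x).1.3)
  · refine h'.eq_or_eq_neg (key x a ha1) (key x b hb1) (key (x + b) a ha1) (hAB x) (hAB' x) ?_ ?_
    · rw [← hBB]; exact hAB _
    · rw [← hBB]; exact hAB' _
  · refine h'.eq_or_eq_neg (key x b hb1) (key x a ha1) (key (x + a) b hb1) (hAB x).symm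
      (fun e => hAB' x (by rw [e, neg_neg])) ?_ ?_
    · rw [← hAA]; exact (hAB _).symm
    · rw [← hAA]; exact fun e => hAB' _ (by rw [e, neg_neg])

/-- If `4a = 4b = 0`, the group is `ℤ/4 × ℤ/4` with basis `a, b`. -/
theorem Ordinary.dvd_of_relation {a b : Γ} (h : Ordinary a b) (ha : a + a = -(a + a))
    (hb : b + b = -(b + b)) {i j : ℤ} (hij : i • a + j • b = 0) : 4 ∣ i ∧ 4 ∣ j := by
  have ha4 : (4 : ℤ) • a = 0 := by linear_combination (norm := module) ha
  have hb4 : (4 : ℤ) • b = 0 := by linear_combination (norm := module) hb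
  have h1 : (i % 4) • a + (j % 4) • b = 0 := by
    rw [← hij]
    nth_rw 2 [← Int.mul_ediv_add_emod i 4, ← Int.mul_ediv_add_emod j 4]
    rw [add_zsmul, add_zsmul, mul_comm, mul_comm 4, mul_zsmul, mul_zsmul, ha4, hb4]
    simp
  rw [Int.dvd_iff_emod_eq_zero, Int.dvd_iff_emod_eq_zero]
  have hi := Int.emod_nonneg i (show (4 : ℤ) ≠ 0 by decide)
  have hi' := Int.emod_lt_of_pos i (show (0 : ℤ) < 4 by decide)
  have hj := Int.emod_nonneg j (show (4 : ℤ) ≠ 0 by decide)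
  have hj' := Int.emod_lt_of_pos j (show (0 : ℤ) < 4 by decide)
  -- doubling the relation shows that `i` and `j` are even
  have h2 : (2 * (i % 4)) • a + (2 * (j % 4)) • b = 0 := by
    rw [mul_zsmul, mul_zsmul, ← zsmul_add, h1, zsmul_zero]
  generalize i % 4 = p at *
  generalize j % 4 = q at *
  have hp : p = 0 ∨ p = 1 ∨ p = 2 ∨ p = 3 := by omega
  have hq : q = 0 ∨ q = 1 ∨ q = 2 ∨ q = 3 := by omega
  have k1 : (2 : ℤ) • a ≠ 0 := fun e => h.1 (by linear_combination (norm := module) e)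
  have k2 : (2 : ℤ) • b ≠ 0 := fun e => h.2 (by linear_combination (norm := module) e)
  have k3 : (2 : ℤ) • a + (2 : ℤ) • b ≠ 0 := fun e => h.4 (by linear_combination (norm := module) e)
  have six : (6 : ℤ) • a = (2 : ℤ) • a := by linear_combination (norm := module) ha4
  have six' : (6 : ℤ) • b = (2 : ℤ) • b := by linear_combination (norm := module) hb4
  rcases hp with rfl | rfl | rfl | rfl <;> rcases hq with rfl | rfl | rfl | rfl <;>
    simp_all

theorem adam_of_ordinary [Finite Γ] {a b : Γ} {a' b' : Γ'} (hg : Generates a b)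
    (hg' : Generates a' b') {f : Γ ≃ Γ'}
    (hf : IsCayleyIso a b a' b' f) (h : Ordinary a b) (h' : Ordinary a' b') : Adam a b a' b' := by
  have := Finite.of_equiv Γ f
  have hTT : ThriceRelated a b ↔ ThriceRelated a' b' := by
    rw [← h.exists_walk_eq_three_iff, ← h'.exists_walk_eq_three_iff]
    constructor
    · rintro ⟨d, hd⟩
      exact ⟨f d - f 0, by rw [hf.walk, sub_zero, hd]⟩
    · rintro ⟨d, hd⟩
      exact ⟨f.symm d - f.symm 0, by rw [hf.symm.walk, sub_zero, hd]⟩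
  by_cases hT : ThriceRelated a b
  · exact hT.adam hg hg' (Nat.card_congr f) (hTT.1 hT)
  have hT' := fun e => hT (hTT.2 e)
  -- a generator `c` of either pair with `4c ≠ 0` gives an odd number of walks to work with
  by_cases hb : b + b = -(b + b)
  swap
  · exact adam_of_ordinary_aux hg hf h h' hT' hb
  by_cases ha : a + a = -(a + a)
  swap
  · exact (adam_of_ordinary_aux hg.swap (hf.congr (connectionList_swap _ _) rfl) h.swap h' hT'
      ha).congr (connectionList_swap _ _) rfl
  by_cases hb' : b' + b' = -(b' + b')
  swap
  · exact (adam_of_ordinary_aux hg' hf.symm h' h hT hb').symm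
  by_cases ha' : a' + a' = -(a' + a')
  swap
  · exact ((adam_of_ordinary_aux hg'.swap (hf.symm.congr (connectionList_swap _ _) rfl) h'.swap h hT
      ha').congr (connectionList_swap _ _) rfl).symm
  obtain ⟨τ, h1, h2⟩ := exists_addEquiv_of_relations hg hg' (Nat.card_congr f) fun i j hij => by
    obtain ⟨⟨i, rfl⟩, ⟨j, rfl⟩⟩ := h.dvd_of_relation ha hb hij
    linear_combination (norm := module) i • ha' + j • hb'
  exact adam_of_addEquiv τ h1 h2

/-! ### Multiple edges and loops -/

theorem Generates.of_eq_or_eq_neg {a b : Γ} (hg : Generates a b) (h : a = b ∨ a = -b) (x : Γ) :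
    ∃ i : ℤ, x = i • b := by
  obtain ⟨i, j, rfl⟩ := hg x
  rcases h with rfl | rfl
  · exact ⟨i + j, by module⟩
  · exact ⟨j - i, by module⟩

theorem connectionList_of_eq_or_eq_neg {a b : Γ} (h : a = b ∨ a = -b) :
    connectionList b ((1 : ℤ) • b) = connectionList a b := by
  rw [one_zsmul]
  rcases h with rfl | rfl
  · rfl
  · rw [connectionList_neg_left]

theorem adam_of_eq_or_eq_neg [Finite Γ] {a b : Γ} {a' b' : Γ'} (hg : Generates a b)
    (hg' : Generates a' b') (hc : Nat.card Γ = Nat.card Γ') (h : a = b ∨ a = -b)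
    (h' : a' = b' ∨ a' = -b') : Adam a b a' b' :=
  adam_of_cyclic (hg.of_eq_or_eq_neg h) (hg'.of_eq_or_eq_neg h') hc 1
    (connectionList_of_eq_or_eq_neg h) (connectionList_of_eq_or_eq_neg h')

open Classical in
/-- If `a` has order at most two, its multiplicity tells it apart from `±b`. -/
theorem mult_involution {a b : Γ} (h1 : a ≠ b) (h2 : a ≠ -b) (ha : a + a = 0) (hb : b + b ≠ 0)
    (d : Γ) : (mult a b d = 2 ↔ d = a) ∧ (mult a b d = 1 ↔ d = b ∨ d = -b) := by
  have ha' : -a = a := by linear_combination (norm := abel) -ha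
  have hb' : b ≠ -b := fun e => hb (by linear_combination (norm := abel) e)
  rw [mult_eq, ha']
  by_cases e1 : d = a
  · subst e1
    simp [h1, h2]
  by_cases e2 : d = b
  · subst e2
    simp [e1, hb']
  · by_cases e3 : d = -b <;> simp [e1, e2, e3]
    · grind

theorem adam_of_involution [Finite Γ] {a b : Γ} {a' b' : Γ'} (hg : Generates a b) {f : Γ ≃ Γ'}
    (hf : IsCayleyIso a b a' b' f) (h1 : a ≠ b) (h2 : a ≠ -b) (ha : a + a = 0) (hb : b + b ≠ 0)
    (h1' : a' ≠ b') (h2' : a' ≠ -b') (ha' : a' + a' = 0) (hb' : b' + b' ≠ 0) : Adam a b a' b' := by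
  have hA : ∀ x, f (x + a) - f x = a' := fun x => by
    rw [← (mult_involution h1' h2' ha' hb' _).1, hf, add_sub_cancel_left,
      (mult_involution h1 h2 ha hb _).1]
  have hB : ∀ x, f (x + b) - f x = b' ∨ f (x + b) - f x = -b' := fun x => by
    rw [← (mult_involution h1' h2' ha' hb' _).2, hf, add_sub_cancel_left,
      (mult_involution h1 h2 ha hb _).2]
    exact Or.inl rfl
  refine adam_of_locally_affine hg f (fun x => f (x + a) - f x) (fun x => f (x + b) - f x)
    (fun x => (add_sub_cancel _ _).symm) (fun x => (add_sub_cancel _ _).symm) ?_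
    (fun x => by rw [hA, hA]) (fun x => ?_) (fun x => Or.inl (by rw [hA, hA])) (fun x => ?_)
    (fun x => ?_) (fun x => ?_)
  · simp only [hA]
    rcases hB 0 with e | e <;> rw [e]
    rw [connectionList_neg]
  · have hne : f (x + b + b) ≠ f x := fun e => hb (by
      have := f.injective e
      linear_combination (norm := abel) this)
    rcases hB x with e | e <;> rcases hB (x + b) with e1 | e1
    · rw [e, e1]
    · exact absurd (by linear_combination (norm := abel) e + e1) hne
    · exact absurd (by linear_combination (norm := abel) e + e1) hne
    · rw [e, e1]
  · rcases hB x with e | e <;> rcases hB (x + a) with e1 | e1 <;> simp [e, e1]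
  · rcases hB x with e | e <;> simp only [e]
    · exact hb'
    · exact fun e2 => hb' (by linear_combination (norm := abel) -e2)
  · simp only [hA, ha']
    rcases hB x with e | e <;> simp only [e]
    · exact hb'.symm
    · exact fun e2 => hb' (by linear_combination (norm := abel) e2)

theorem involution_of_not_ordinary {a b : Γ} (ht : ¬ Twisted a b) (h1 : a ≠ b) (h2 : a ≠ -b)
    (h : ¬ Ordinary a b) : a + a = 0 ∧ b + b ≠ 0 ∨ b + b = 0 ∧ a + a ≠ 0 := by
  by_cases h6 : a + a = 0
  · exact Or.inl ⟨h6, fun h7 => ht (Or.inl ⟨h1, h6.trans h7.symm⟩)⟩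
  · refine Or.inr ⟨?_, h6⟩
    by_contra h7
    exact h ⟨h6, h7, fun e => ht (Or.inl ⟨h1, e⟩), fun e => ht (Or.inr ⟨h2, e⟩)⟩

/-- The cases are told apart by the multiplicities: they are all even for a doubled cycle, at most
one for an ordinary pair, and otherwise one generator has order at most two. -/
theorem adam_of_not_twisted [Finite Γ] {a b : Γ} {a' b' : Γ'} (hg : Generates a b)
    (hg' : Generates a' b') {f : Γ ≃ Γ'}
    (hf : IsCayleyIso a b a' b' f) (ht : ¬ Twisted a b) : Adam a b a' b' := by
  have := Finite.of_equiv Γ f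
  have ht' : ¬ Twisted a' b' := fun h => ht (hf.symm.twisted h)
  have htrans : ∀ P : ℕ → Prop, (∀ d, P (mult a b d)) ↔ ∀ d, P (mult a' b' d) := fun P =>
    ⟨fun h d => by
      have := hf.symm (f 0) (d + f 0)
      rw [add_sub_cancel_right] at this
      rw [← this]
      exact h _, fun h d => by
      have := hf (f.symm 0) (d + f.symm 0)
      rw [add_sub_cancel_right] at this
      rw [← this]
      exact h _⟩
  by_cases h1 : ∀ d, Even (mult a b d)
  · exact adam_of_eq_or_eq_neg hg hg' (Nat.card_congr f) ((even_mult_iff ht).1 h1)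
      ((even_mult_iff ht').1 ((htrans _).1 h1))
  have h1' : ¬ ∀ d, Even (mult a' b' d) := fun h => h1 ((htrans _).2 h)
  rw [even_mult_iff ht, not_or] at h1
  rw [even_mult_iff ht', not_or] at h1'
  by_cases h : Ordinary a b
  · refine adam_of_ordinary hg hg' hf h ?_
    by_contra h'
    obtain ⟨d, hd⟩ := two_le_mult_of_not_ordinary h' ht'
    exact absurd ((htrans (· ≤ 1)).1 h.mult_le_one d) (by omega)
  · obtain ⟨d, hd⟩ := two_le_mult_of_not_ordinary h ht
    have h' : ¬ Ordinary a' b' := fun h' => absurd ((htrans (· ≤ 1)).2 h'.mult_le_one d) (by omega)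
    have n1 : b ≠ -a := fun e => h1.2 (by rw [e, neg_neg])
    have n1' : b' ≠ -a' := fun e => h1'.2 (by rw [e, neg_neg])
    rcases involution_of_not_ordinary ht h1.1 h1.2 h with ⟨e1, e2⟩ | ⟨e1, e2⟩ <;>
      rcases involution_of_not_ordinary ht' h1'.1 h1'.2 h' with ⟨e1', e2'⟩ | ⟨e1', e2'⟩
    · exact adam_of_involution hg hf h1.1 h1.2 e1 e2 h1'.1 h1'.2 e1' e2'
    · exact (adam_of_involution hg (hf.congr rfl (connectionList_swap _ _)) h1.1 h1.2 e1 e2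
        (Ne.symm h1'.1) n1' e1' e2').congr rfl (connectionList_swap _ _)
    · exact (adam_of_involution hg.swap (hf.congr (connectionList_swap _ _) rfl)
        (Ne.symm h1.1) n1 e1 e2 h1'.1 h1'.2 e1' e2').congr (connectionList_swap _ _) rfl
    · exact (adam_of_involution hg.swap
        (hf.congr (connectionList_swap _ _) (connectionList_swap _ _))
        (Ne.symm h1.1) n1 e1 e2 (Ne.symm h1'.1) n1' e1' e2').congr (connectionList_swap _ _)
        (connectionList_swap _ _)

/-! ### Blow-ups of cycles -/

theorem Twisted.exists_eq {a b : Γ} (h : Twisted a b) : ∃ b₁ : Γ, (b₁ = b ∨ b₁ = -b) ∧ a ≠ b₁ ∧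
    a + a = b₁ + b₁ := by
  rcases h with ⟨h0, h⟩ | ⟨h0, h⟩
  · exact ⟨b, Or.inl rfl, h0, h⟩
  · exact ⟨-b, Or.inr rfl, h0, by rw [h, neg_add]⟩

/-- After changing the sign of `b`, a twisted pair satisfies `2a = 2b`. -/
theorem Twisted.normalize {a b : Γ} (hg : Generates a b) (h : Twisted a b) :
    ∃ b₁ : Γ, connectionList a b₁ = connectionList a b ∧ Generates a b₁ ∧ a ≠ b₁ ∧
      a + a = b₁ + b₁ := by
  obtain ⟨b₁, rfl | rfl, h1, h2⟩ := h.exists_eq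
  · exact ⟨_, rfl, hg, h1, h2⟩
  · exact ⟨_, connectionList_neg _ _, hg.neg, h1, h2⟩

theorem mem_zmultiples_involution {δ x : Γ} (h2 : δ + δ = 0) :
    x ∈ AddSubgroup.zmultiples δ ↔ x = 0 ∨ x = δ := by
  rw [AddSubgroup.mem_zmultiples_iff]
  constructor
  · rintro ⟨k, rfl⟩
    rcases Int.even_or_odd' k with ⟨m, rfl | rfl⟩
    · left; linear_combination (norm := module) m • h2
    · right; linear_combination (norm := module) m • h2
  · rintro (rfl | rfl)
    · exact ⟨0, by simp⟩
    · exact ⟨1, by simp⟩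

theorem card_zmultiples_involution {δ : Γ} (h0 : δ ≠ 0) (h2 : δ + δ = 0) :
    Nat.card (AddSubgroup.zmultiples δ) = 2 := by
  rw [Nat.card_zmultiples]
  exact addOrderOf_eq_prime (by rw [two_nsmul, h2]) h0

theorem Twisted.even_card [Finite Γ] {a b : Γ} (h : Twisted a b) : 2 ∣ Nat.card Γ := by
  obtain ⟨b₁, -, h1, h2⟩ := h.exists_eq
  rw [← card_zmultiples_involution (sub_ne_zero.2 h1)
    (by linear_combination (norm := abel) h2)]
  exact AddSubgroup.card_addSubgroup_dvd_card _

open Classical in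
/-- The multiplicity of `d` depends only on the class of `d` modulo the involution `a - b`: the
graph is the blow-up of a cycle. -/
theorem mult_eq_of_twisted {a b : Γ} (h : a ≠ b) (h2 : a + a = b + b) (d : Γ) :
    mult a b d =
      (if (d : Γ ⧸ AddSubgroup.zmultiples (a - b)) = (a : Γ ⧸ AddSubgroup.zmultiples (a - b))
        then 1 else 0) +
      (if (d : Γ ⧸ AddSubgroup.zmultiples (a - b)) = -(a : Γ ⧸ AddSubgroup.zmultiples (a - b))
        then 1 else 0) := by
  have hδ : (a - b) + (a - b) = 0 := by linear_combination (norm := abel) h2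
  have e1 : ∀ c : Γ, (d : Γ ⧸ AddSubgroup.zmultiples (a - b)) = (c : Γ ⧸ _) ↔
      d = c ∨ d = c + (a - b) := fun c => by
    rw [eq_comm, QuotientAddGroup.eq, mem_zmultiples_involution hδ]
    exact or_congr (by rw [neg_add_eq_zero, eq_comm]) (by rw [neg_add_eq_iff_eq_add])
  rw [← QuotientAddGroup.mk_neg, mult_eq]
  simp only [e1, show a + (a - b) = b by linear_combination (norm := abel) h2,
    show -a + (a - b) = -b by abel]
  have hn : d = a → d ≠ b := fun e e' => h (e.symm.trans e')
  have hn' : d = -a → d ≠ -b := fun e e' => h (neg_injective (e.symm.trans e'))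
  have key : ∀ p q r s : Prop, ∀ [Decidable p] [Decidable q] [Decidable r] [Decidable s]
      [Decidable (p ∨ r)] [Decidable (q ∨ s)], (p → ¬ r) → (q → ¬ s) →
      (if p then 1 else 0) + (if q then 1 else 0) + (if r then 1 else 0) + (if s then 1 else 0) =
        (if p ∨ r then 1 else 0) + (if q ∨ s then 1 else 0) := by
    intro p q r s _ _ _ _ _ _ h1 h2
    by_cases hp : p <;> by_cases hq : q <;> by_cases hr : r <;> by_cases hs : s <;> simp_all
  exact key _ _ _ _ hn hn'

/-- Bijections between the fibres of two maps can be glued to a bijection that respects the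
maps. -/
theorem exists_equiv_of_fiber {α β γ : Type*} (p : α → γ) (q : β → γ)
    (h : ∀ c, Nonempty ({x // p x = c} ≃ {y // q y = c})) : ∃ f : α ≃ β, ∀ x, q (f x) = p x :=
  ⟨(Equiv.sigmaFiberEquiv p).symm.trans
    ((Equiv.sigmaCongrRight fun c => (h c).some).trans (Equiv.sigmaFiberEquiv q)),
    fun x => ((h (p x)).some ⟨x, rfl⟩).2⟩

/-- A coset of `K` is in bijection with `K`. -/
def fiberEquivAddSubgroup (K : AddSubgroup Γ) (z : Γ) :
    {x : Γ // (x : Γ ⧸ K) = (z : Γ ⧸ K)} ≃ K where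
  toFun x := ⟨-z + x, QuotientAddGroup.eq.1 x.2.symm⟩
  invFun k := ⟨z + k, (QuotientAddGroup.eq.2 (by simp)).symm⟩
  left_inv x := by simp
  right_inv k := by simp

theorem Generates.generator_quotient {a b : Γ} (hg : Generates a b)
    (x : Γ ⧸ AddSubgroup.zmultiples (a - b)) : ∃ i : ℤ, x = i • (a : Γ ⧸ _) := by
  obtain ⟨x, rfl⟩ := QuotientAddGroup.mk_surjective x
  obtain ⟨i, j, rfl⟩ := hg x
  refine ⟨i + j, ?_⟩
  rw [← QuotientAddGroup.mk_zsmul, eq_comm, QuotientAddGroup.eq]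
  exact ⟨-j, by module⟩

/-- Two twisted pairs in groups of the same order have isomorphic graphs. The quotients by the
involutions are cyclic of the same order, and every bijection that covers the isomorphism of the
quotients is a graph isomorphism. -/
theorem exists_isCayleyIso_of_twisted [Finite Γ] [Finite Γ'] {a b : Γ} {a' b' : Γ'}
    (hg : Generates a b) (hg' : Generates a' b') (h : Twisted a b) (h' : Twisted a' b')
    (hc : Nat.card Γ = Nat.card Γ') : ∃ f : Γ ≃ Γ', IsCayleyIso a b a' b' f := by
  obtain ⟨b₁, he, hg, h1, h2⟩ := h.normalize hg
  obtain ⟨b₁', he', hg', h1', h2'⟩ := h'.normalize hg'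
  suffices hs : ∃ f : Γ ≃ Γ', IsCayleyIso a b₁ a' b₁' f by
    obtain ⟨f, hf⟩ := hs
    exact ⟨f, hf.congr he he'⟩
  have hK := card_zmultiples_involution (sub_ne_zero.2 h1)
    (by linear_combination (norm := abel) h2)
  have hK' := card_zmultiples_involution (sub_ne_zero.2 h1')
    (by linear_combination (norm := abel) h2')
  obtain ⟨τ, hτ⟩ := exists_addEquiv_of_cyclic hg.generator_quotient hg'.generator_quotient (by
    have e1 := AddSubgroup.card_eq_card_quotient_mul_card_addSubgroup
      (AddSubgroup.zmultiples (a - b₁))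
    have e2 := AddSubgroup.card_eq_card_quotient_mul_card_addSubgroup
      (AddSubgroup.zmultiples (a' - b₁'))
    rw [hK] at e1
    rw [hK'] at e2
    omega)
  -- a bijection that covers `τ`, chosen coset by coset
  obtain ⟨f, hf⟩ := exists_equiv_of_fiber (fun x : Γ => τ (x : Γ ⧸ _))
    (fun y : Γ' => (y : Γ' ⧸ AddSubgroup.zmultiples (a' - b₁'))) fun c => by
      obtain ⟨z', rfl⟩ := QuotientAddGroup.mk_surjective c
      obtain ⟨z, hz⟩ := QuotientAddGroup.mk_surjective (τ.symm z')
      refine ⟨(Equiv.subtypeEquivRight fun x => ?_).trans ((fiberEquivAddSubgroup _ z).trans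
        ((Finite.card_eq.1 (hK.trans hK'.symm)).some.trans
          (fiberEquivAddSubgroup _ z').symm))⟩
      rw [hz, ← τ.injective.eq_iff, AddEquiv.apply_symm_apply]
  refine ⟨f, fun x y => ?_⟩
  rw [mult_eq_of_twisted h1 h2, mult_eq_of_twisted h1' h2', QuotientAddGroup.mk_sub,
    QuotientAddGroup.mk_sub, hf, hf, ← hτ, ← map_sub, ← map_neg]
  simp only [τ.injective.eq_iff]

/-- If `|Γ| = 2m` with `m` odd, then `m a` and `m b` are `0` and the involution in some order, so
one of `a`, `b` generates the group. -/
theorem Twisted.exists_odd_form [Finite Γ] {a b : Γ} {m : ℕ} (hg : Generates a b)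
    (h : Twisted a b) (hm : Odd m) (hc : Nat.card Γ = 2 * m) :
    ∃ g : Γ, (∀ x, ∃ i : ℤ, x = i • g) ∧
      connectionList g ((m + 1 : ℤ) • g) = connectionList a b := by
  obtain ⟨b₁, he, hg, h1, h2⟩ := h.normalize hg
  have hδ : (a - b₁) + (a - b₁) = 0 := by linear_combination (norm := abel) h2
  have hK := card_zmultiples_involution (sub_ne_zero.2 h1) hδ
  have e1 := AddSubgroup.card_eq_card_quotient_mul_card_addSubgroup
      (AddSubgroup.zmultiples (a - b₁))
  have hma : m • a ∈ AddSubgroup.zmultiples (a - b₁) := by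
    have hm' : m = Nat.card (Γ ⧸ AddSubgroup.zmultiples (a - b₁)) := by
      rw [hK, hc] at e1
      omega
    rw [← QuotientAddGroup.eq_zero_iff, QuotientAddGroup.mk_nsmul, hm', card_nsmul_eq_zero']
  obtain ⟨k, rfl⟩ := hm
  rw [mem_zmultiples_involution hδ] at hma
  rcases hma with hma | hma
  · obtain rfl : a = ((2 * k + 1 : ℕ) + 1 : ℤ) • b₁ := by
      push_cast
      linear_combination (norm := module) -hma + (k + 1) • h2
    refine ⟨b₁, fun x => ?_, by rw [← he, connectionList_swap]⟩
    obtain ⟨i, j, rfl⟩ := hg x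
    exact ⟨i * ((2 * k + 1 : ℕ) + 1 : ℤ) + j, by module⟩
  · obtain rfl : b₁ = ((2 * k + 1 : ℕ) + 1 : ℤ) • a := by
      push_cast
      linear_combination (norm := module) -hma - h2
    refine ⟨a, fun x => ?_, he⟩
    obtain ⟨i, j, rfl⟩ := hg x
    exact ⟨i + j * ((2 * k + 1 : ℕ) + 1 : ℤ), by module⟩

theorem Twisted.adam_of_odd [Finite Γ] {a b : Γ} {a' b' : Γ'} {m : ℕ} (hg : Generates a b)
    (hg' : Generates a' b') (h : Twisted a b) (h' : Twisted a' b') (hm : Odd m)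
    (hc : Nat.card Γ = 2 * m) (hc' : Nat.card Γ' = 2 * m) : Adam a b a' b' := by
  have : Finite Γ' := Nat.finite_of_card_ne_zero (by rw [hc']; have := hm.pos; omega)
  obtain ⟨g, h1, h2⟩ := h.exists_odd_form hg hm hc
  obtain ⟨g', h1', h2'⟩ := h'.exists_odd_form hg' hm hc'
  exact adam_of_cyclic h1 h1' (hc.trans hc'.symm) (m + 1) h2 h2'

/-! ### Numbers of edges -/

/-- The ends of the edges of the Cayley multigraph of `±a, ±b`. Each vertex is the start of one
edge in direction `a` and of one in direction `b`. -/
def cayleyEnds (a b : Γ) : Γ ⊕ Γ → Sym2 Γ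
  | Sum.inl v => s(v, v + a)
  | Sum.inr v => s(v, v + b)

open Classical in
/-- The factor two for `x = y` accounts for loops, which are counted once as edges and twice in
the connection list. -/
theorem card_filter_ends [Fintype Γ] (a x y : Γ) :
    (if x = y then 2 else 1) * (Finset.univ.filter fun v : Γ => s(v, v + a) = s(x, y)).card =
      (if y - x = a then 1 else 0) + (if y - x = -a then 1 else 0) := by
  by_cases hxy : x = y
  · subst hxy
    have h : (Finset.univ.filter fun v : Γ => s(v, v + a) = s(x, x)) =
        if a = 0 then {x} else ∅ := by
      ext v
      by_cases ha : a = 0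
      · simp [ha]
      · simp only [Finset.mem_filter, Finset.mem_univ, true_and, Sym2.eq_iff, if_neg ha]
        simp only [or_self, Finset.notMem_empty, iff_false, not_and]
        rintro rfl
        simpa using ha
    rw [h, if_pos rfl, sub_self]
    by_cases ha : a = 0
    · simp [ha]
    · simp [ha, eq_comm (a := (0 : Γ))]
  · have h : (Finset.univ.filter fun v : Γ => s(v, v + a) = s(x, y)) =
        (if y - x = a then {x} else ∅) ∪ (if y - x = -a then {y} else ∅) := by
      ext v
      simp only [Finset.mem_filter, Finset.mem_univ, true_and, Sym2.eq_iff, Finset.mem_union]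
      refine or_congr ?_ ?_
      · split_ifs with e
        · simp only [Finset.mem_singleton, and_iff_left_iff_imp]
          rintro rfl
          rw [← e, add_sub_cancel]
        · simp only [Finset.notMem_empty, iff_false, not_and]
          rintro rfl e1
          exact e (by rw [← e1, add_sub_cancel_left])
      · split_ifs with e
        · simp only [Finset.mem_singleton, and_iff_left_iff_imp]
          rintro rfl
          linear_combination (norm := abel) e
        · simp only [Finset.notMem_empty, iff_false, not_and]
          rintro rfl e1
          exact e (by linear_combination (norm := abel) e1)
    rw [h, if_neg hxy, one_mul, Finset.card_union_of_disjoint]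
    · congr 1 <;> split_ifs <;> simp
    · split_ifs <;> simp [hxy]

open Classical in
theorem mult_eq_card [Finite Γ] (a b x y : Γ) :
    mult a b (y - x) = (if x = y then 2 else 1) * Nat.card {e // cayleyEnds a b e = s(x, y)} := by
  have := Fintype.ofFinite Γ
  have h : Nat.card {e // cayleyEnds a b e = s(x, y)} =
      (Finset.univ.filter fun v : Γ => s(v, v + a) = s(x, y)).card +
        (Finset.univ.filter fun v : Γ => s(v, v + b) = s(x, y)).card := by
    rw [Nat.card_eq_fintype_card, Fintype.card_subtype, Finset.card_filter,
      Fintype.sum_sum_type, Finset.card_filter, Finset.card_filter]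
    rfl
  rw [h, mul_add, card_filter_ends, card_filter_ends, mult_eq, ← add_assoc]

theorem isCayleyIso_iff_card [Finite Γ] {a b : Γ} {a' b' : Γ'} (f : Γ ≃ Γ') :
    IsCayleyIso a b a' b' f ↔ ∀ x y, Nat.card {e // cayleyEnds a b e = s(x, y)} =
      Nat.card {e // cayleyEnds a' b' e = s(f x, f y)} := by
  classical
  have := Finite.of_equiv Γ f
  refine forall_congr' fun x => forall_congr' fun y => ?_
  rw [mult_eq_card, mult_eq_card, eq_comm]
  simp only [f.injective.eq_iff]
  split_ifs
  · exact Nat.mul_right_inj two_ne_zero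
  · simp only [one_mul]

end CayleyMultigraphs

/-! ### The Cayley representation of `X(s, t, r)` -/

theorem mk_eq_zsmul (s t r : ℕ) (i j : ℤ) :
    (QuotientAddGroup.mk (i, j) : CayGroup s t r) = i • gen₁ s t r + j • gen₂ s t r := by
  rw [gen₁, gen₂, ← QuotientAddGroup.mk_zsmul, ← QuotientAddGroup.mk_zsmul,
    ← QuotientAddGroup.mk_add]
  congr 1
  simp

theorem generates_gen (s t r : ℕ) : Generates (gen₁ s t r) (gen₂ s t r) := fun x => by
  obtain ⟨⟨i, j⟩, rfl⟩ := QuotientAddGroup.mk_surjective x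
  exact ⟨i, j, mk_eq_zsmul s t r i j⟩

/-- The relation `i γ₁ + j γ₂ = 0` in the group with parameters `s`, `t`, `r`. The parameters are
integers here, so that `r` can change its sign. -/
def Rel (s t r i j : ℤ) : Prop := ∃ n : ℤ, j = t * n ∧ s ∣ i + r * n

theorem rel_iff (s t r : ℕ) (i j : ℤ) :
    i • gen₁ s t r + j • gen₂ s t r = 0 ↔ Rel s t r i j := by
  rw [← mk_eq_zsmul, QuotientAddGroup.eq_zero_iff, relations, AddSubgroup.mem_closure_pair]
  constructor
  · rintro ⟨m, n, h⟩
    simp only [Prod.smul_mk, smul_eq_mul, Prod.mk_add_mk, Prod.mk.injEq] at h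
    exact ⟨n, by rw [← h.2]; ring, m, by rw [← h.1]; ring⟩
  · rintro ⟨n, rfl, m, h⟩
    refine ⟨m, n, ?_⟩
    simp only [Prod.smul_mk, smul_eq_mul, Prod.mk_add_mk, Prod.mk.injEq]
    exact ⟨by linear_combination -h, by ring⟩

theorem zsmul_gen₁_congr {s t r : ℕ} {i j : ℤ} (h : (i : ZMod s) = j) :
    i • gen₁ s t r = j • gen₁ s t r := by
  have h1 : (i - j) • gen₁ s t r + (0 : ℤ) • gen₂ s t r = 0 := by
    rw [rel_iff]
    refine ⟨0, by simp, ?_⟩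
    rw [mul_zero, add_zero]
    exact (ZMod.intCast_eq_intCast_iff_dvd_sub j i s).1 h.symm
  linear_combination (norm := module) h1

theorem zsmul_gen₂ (s t r : ℕ) : (t : ℤ) • gen₂ s t r = (r : ℤ) • gen₁ s t r := by
  have h1 : (-r : ℤ) • gen₁ s t r + (t : ℤ) • gen₂ s t r = 0 := by
    rw [rel_iff]
    exact ⟨1, by simp, by simp⟩
  linear_combination (norm := module) h1

/-- The vertex `x^i_j` as the element `j γ₁ + i γ₂` of the group. -/
def toCay (s t r : ℕ) (v : Vert s t) : CayGroup s t r :=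
  (v.2.val : ℤ) • gen₁ s t r + ((v.1 : ℕ) : ℤ) • gen₂ s t r

theorem toCay_right (s t r : ℕ) [NeZero s] (v : Vert s t) :
    toCay s t r (v.1, v.2 + 1) = toCay s t r v + gen₁ s t r := by
  have h : ((v.2 + 1).val : ℤ) • gen₁ s t r = ((v.2.val : ℤ) + 1) • gen₁ s t r :=
    zsmul_gen₁_congr (by push_cast; simp)
  simp only [toCay, h]
  module

theorem toCay_up (s t r : ℕ) [NeZero s] (v : Vert s t) :
    toCay s t r (up s t r v) = toCay s t r v + gen₂ s t r := by
  unfold up toCay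
  split_ifs with h
  · push_cast; module
  · have h1 : ((v.2 + (r : ZMod s)).val : ℤ) • gen₁ s t r =
        ((v.2.val : ℤ) + r) • gen₁ s t r :=
      zsmul_gen₁_congr (by push_cast; simp)
    have h2 : ((v.1 : ℕ) : ℤ) = t - 1 := by have := v.1.2; omega
    simp only [h1, h2]
    linear_combination (norm := module) -zsmul_gen₂ s t r

theorem toCay_bijective (s t r : ℕ) [NeZero s] (ht : 1 ≤ t) :
    Function.Bijective (toCay s t r) := by
  constructor
  · rintro ⟨i, x⟩ ⟨j, y⟩ h
    have h1 : ((x.val : ℤ) - y.val) • gen₁ s t r + ((i : ℕ) - (j : ℕ) : ℤ) • gen₂ s t r = 0 := by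
      simp only [toCay] at h
      linear_combination (norm := module) h
    rw [rel_iff] at h1
    obtain ⟨n, h2, h3⟩ := h1
    -- two rows differ by less than `t`, so the relation involves no diagonal edge
    have hn : n = 0 := by
      have hi := i.2
      have hj := j.2
      by_contra hn
      have : (t : ℤ) ≤ |(t : ℤ) * n| := by
        rw [abs_mul, Nat.abs_cast]
        exact le_mul_of_one_le_right (by positivity) (Int.one_le_abs hn)
      rw [← h2] at this
      have h4 : |((i : ℕ) - (j : ℕ) : ℤ)| < t := by rw [abs_lt]; constructor <;> omega
      omega
    subst hn
    rw [mul_zero] at h2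
    rw [mul_zero, add_zero] at h3
    have hij : i = j := Fin.ext (by omega)
    have hxy : x = y := by
      have := (ZMod.intCast_zmod_eq_zero_iff_dvd _ s).2 h3
      push_cast at this
      simpa [sub_eq_zero] using this
    rw [hij, hxy]
  · intro g
    obtain ⟨⟨p, q⟩, rfl⟩ := QuotientAddGroup.mk_surjective g
    have hq := Int.emod_nonneg q (show (t : ℤ) ≠ 0 by omega)
    have hq' := Int.emod_lt_of_pos q (show (0 : ℤ) < t by omega)
    refine ⟨(⟨(q % t).toNat, by omega⟩, ((p + r * (q / t) : ℤ) : ZMod s)), ?_⟩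
    have h1 : ((((p + r * (q / t) : ℤ) : ZMod s).val : ℕ) : ℤ) • gen₁ s t r =
        (p + r * (q / t)) • gen₁ s t r := zsmul_gen₁_congr (by push_cast; simp)
    have h2 : q = t * (q / t) + q % t := (Int.mul_ediv_add_emod q t).symm
    rw [mk_eq_zsmul]
    simp only [toCay, h1, Int.toNat_of_nonneg hq]
    conv_rhs => rw [h2]
    linear_combination (norm := module) -(q / t) • zsmul_gen₂ s t r

/-- The vertices of `X(s, t, r)` are the elements of the group. -/
noncomputable def cayEquiv (s t r : ℕ) [NeZero s] (ht : 1 ≤ t) : Vert s t ≃ CayGroup s t r :=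
  Equiv.ofBijective _ (toCay_bijective s t r ht)

theorem finite_cayGroup {s t : ℕ} (r : ℕ) (hs : 1 ≤ s) (ht : 1 ≤ t) : Finite (CayGroup s t r) :=
  have : NeZero s := ⟨by omega⟩
  Finite.of_equiv _ (cayEquiv s t r ht)

theorem card_cayGroup {s t : ℕ} (r : ℕ) (hs : 1 ≤ s) (ht : 1 ≤ t) :
    Nat.card (CayGroup s t r) = s * t := by
  have : NeZero s := ⟨by omega⟩
  rw [← Nat.card_congr (cayEquiv s t r ht)]
  simp [mul_comm]

theorem card_ends_eq (s t r : ℕ) [NeZero s] (ht : 1 ≤ t) (x y : Vert s t) :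
    Nat.card {e // ends s t r e = s(x, y)} = Nat.card {e // cayleyEnds (gen₁ s t r) (gen₂ s t r) e =
      s(cayEquiv s t r ht x, cayEquiv s t r ht y)} := by
  let φ := cayEquiv s t r ht
  refine Nat.card_congr ((φ.sumCongr φ).subtypeEquiv fun e => ?_)
  have h : cayleyEnds (gen₁ s t r) (gen₂ s t r) (φ.sumCongr φ e) = (ends s t r e).map φ := by
    rcases e with v | v
    · change s(φ v, φ v + gen₁ s t r) = s(φ v, φ (v.1, v.2 + 1))
      rw [show φ (v.1, v.2 + 1) = φ v + gen₁ s t r from toCay_right s t r v]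
    · change s(φ v, φ v + gen₂ s t r) = s(φ v, φ (up s t r v))
      rw [show φ (up s t r v) = φ v + gen₂ s t r from toCay_up s t r v]
  rw [h, show s(φ x, φ y) = (s(x, y)).map φ from rfl, (Sym2.map.injective φ.injective).eq_iff]

/-- Multigraphs are isomorphic if a bijection of the vertices respects the numbers of edges: the
bijections of the edges between any two vertices can be chosen freely. -/
theorem isomorphic_iff_card {s t r s' t' r' : ℕ} (hs : 1 ≤ s) (hs' : 1 ≤ s') :
    Isomorphic (X s t r) (X s' t' r') ↔ ∃ f : Vert s t ≃ Vert s' t',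
      ∀ x y, Nat.card {e // ends s t r e = s(x, y)} =
        Nat.card {e // ends s' t' r' e = s(f x, f y)} := by
  have : NeZero s := ⟨by omega⟩
  have : NeZero s' := ⟨by omega⟩
  constructor
  · rintro ⟨φ⟩
    refine ⟨(Equiv.Set.univ _).symm.trans (φ.vertexEquiv.trans (Equiv.Set.univ _)), fun x y => ?_⟩
    refine Nat.card_congr (((Equiv.Set.univ _).symm.trans (φ.edgeEquiv.trans
      (Equiv.Set.univ _))).subtypeEquiv fun e => ?_)
    exact φ.isLink_iff ⟨e, trivial⟩ ⟨x, trivial⟩ ⟨y, trivial⟩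
  · rintro ⟨f, hf⟩
    obtain ⟨ψ, hψ⟩ := exists_equiv_of_fiber (fun e => (ends s t r e).map f) (ends s' t' r')
      fun c => by
        induction c with
        | _ x' y' =>
          obtain ⟨x, rfl⟩ := f.surjective x'
          obtain ⟨y, rfl⟩ := f.surjective y'
          refine ⟨(Equiv.subtypeEquivRight fun e => ?_).trans (Finite.card_eq.1 (hf x y)).some⟩
          rw [show s(f x, f y) = (s(x, y)).map f from rfl,
            (Sym2.map.injective f.injective).eq_iff]
    refine ⟨⟨(Equiv.Set.univ _).trans (f.trans (Equiv.Set.univ _).symm),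
      (Equiv.Set.univ _).trans (ψ.trans (Equiv.Set.univ _).symm), fun e x y => ?_⟩⟩
    change ends s t r e = s(x.1, y.1) ↔ ends s' t' r' (ψ e) = s(f x, f y)
    rw [hψ, show s(f x, f y) = (s(x.1, y.1)).map f from rfl,
      (Sym2.map.injective f.injective).eq_iff]

theorem isomorphic_iff {s t r s' t' r' : ℕ} (hs : 1 ≤ s) (ht : 1 ≤ t) (hs' : 1 ≤ s')
    (ht' : 1 ≤ t') :
    Isomorphic (X s t r) (X s' t' r') ↔ ∃ f : CayGroup s t r ≃ CayGroup s' t' r',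
      IsCayleyIso (gen₁ s t r) (gen₂ s t r) (gen₁ s' t' r') (gen₂ s' t' r') f := by
  have : NeZero s := ⟨by omega⟩
  have : NeZero s' := ⟨by omega⟩
  have := finite_cayGroup r hs ht
  rw [isomorphic_iff_card hs hs']
  let φ := cayEquiv s t r ht
  let φ' := cayEquiv s' t' r' ht'
  constructor
  · rintro ⟨f, hf⟩
    refine ⟨φ.symm.trans (f.trans φ'), (isCayleyIso_iff_card _).2 fun x y => ?_⟩
    obtain ⟨x, rfl⟩ := φ.surjective x
    obtain ⟨y, rfl⟩ := φ.surjective y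
    rw [← card_ends_eq, hf, card_ends_eq s' t' r' ht']
    simp [φ']
  · rintro ⟨f, hf⟩
    refine ⟨φ.trans (f.trans φ'.symm), fun x y => ?_⟩
    rw [card_ends_eq s t r ht, (isCayleyIso_iff_card _).1 hf, card_ends_eq s' t' r' ht']
    simp [φ, φ']

theorem adamIsomorphic_iff {s t r s' t' r' : ℕ} : AdamIsomorphic s t r s' t' r' ↔
    Adam (gen₁ s t r) (gen₂ s t r) (gen₁ s' t' r') (gen₂ s' t' r') :=
  ⟨fun ⟨_, τ, _, h, _⟩ => ⟨τ, h⟩, fun ⟨τ, h⟩ => ⟨τ, τ, 0, h, fun _ => (zero_add _).symm⟩⟩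

/-! ### Parameters of Ádám isomorphic graphs -/

theorem adam_iff {Γ Γ' : Type*} [AddCommGroup Γ] [AddCommGroup Γ'] {a b : Γ} {a' b' : Γ'} :
    Adam a b a' b' ↔ ∃ τ : Γ ≃+ Γ', ((τ a = a' ∨ τ a = -a') ∧ (τ b = b' ∨ τ b = -b')) ∨
      ((τ a = b' ∨ τ a = -b') ∧ (τ b = a' ∨ τ b = -a')) := by
  have key : ∀ {c d u v : Γ'}, connectionList c d = connectionList u v → (c = u ∨ c = -u) →
      d = v ∨ d = -v := by
    intro c d u v h hc
    have h1 : connectionList u d = connectionList u v := by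
      rcases hc with rfl | rfl
      · exact h
      · rwa [connectionList_neg_left] at h
    simp only [connectionList, Multiset.insert_eq_cons, Multiset.cons_inj_right] at h1
    have h2 : d ∈ (v ::ₘ {-v} : Multiset Γ') := by rw [← h1]; simp
    simpa using h2
  refine exists_congr fun τ => ?_
  have hmap : (connectionList a b).map τ = connectionList (τ a) (τ b) := by simp [connectionList]
  rw [hmap]
  constructor
  · intro h
    have h1 : τ a ∈ connectionList a' b' := by rw [← h]; simp [connectionList]
    have h2 : (τ a = a' ∨ τ a = -a') ∨ (τ a = b' ∨ τ a = -b') := by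
      simpa [connectionList, or_assoc] using h1
    rcases h2 with h2 | h2
    · exact Or.inl ⟨h2, key h h2⟩
    · exact Or.inr ⟨h2, key (h.trans (connectionList_swap _ _)) h2⟩
  · rintro (⟨h1, h2⟩ | ⟨h1, h2⟩)
    · rcases h1 with h1 | h1 <;> rcases h2 with h2 | h2 <;>
        simp [h1, h2, connectionList_neg, connectionList_neg_left]
    · rw [connectionList_swap a']
      rcases h1 with h1 | h1 <;> rcases h2 with h2 | h2 <;>
        simp [h1, h2, connectionList_neg, connectionList_neg_left]

theorem rel_neg_neg {s t r i j : ℤ} : Rel s t r (-i) (-j) ↔ Rel s t r i j := by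
  constructor <;> rintro ⟨n, h1, h2⟩
  · exact ⟨-n, by linarith, by rwa [show i + r * -n = -(-i + r * n) by ring, dvd_neg]⟩
  · exact ⟨-n, by linarith, by rwa [show -i + r * -n = -(i + r * n) by ring, dvd_neg]⟩

theorem rel_neg_right {s t r i j : ℤ} : Rel s t r i (-j) ↔ Rel s t (-r) i j := by
  constructor <;> rintro ⟨n, h1, h2⟩ <;> exact ⟨-n, by linarith, by simpa using h2⟩

theorem rel_neg_left {s t r i j : ℤ} : Rel s t r (-i) j ↔ Rel s t (-r) i j := by
  rw [← rel_neg_right, ← rel_neg_neg, neg_neg]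

theorem Rel.congr_mod {s t r r' i j : ℤ} (h : r ≡ r' [ZMOD s]) :
    Rel s t r i j ↔ Rel s t r' i j := by
  refine exists_congr fun n => and_congr_right fun _ => ?_
  have h1 := (h.mul_right n).add_left i
  rw [Int.dvd_iff_emod_eq_zero, Int.dvd_iff_emod_eq_zero, h1.eq]

/-- The relations determine `s`, `t` and the class of `r` modulo `s`. -/
theorem rel_unique {s t s' t' : ℕ} {r r' : ℤ} (ht : 1 ≤ t) (ht' : 1 ≤ t')
    (h : ∀ i j, Rel s t r i j ↔ Rel s' t' r' i j) : s' = s ∧ t' = t ∧ r' ≡ r [ZMOD s] := by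
  have hs : ∀ {s t : ℕ} {r : ℤ}, 1 ≤ t → ∀ i, Rel s t r i 0 ↔ (s : ℤ) ∣ i := by
    intro s t r ht i
    constructor
    · rintro ⟨n, h1, h2⟩
      have : n = 0 := by
        rcases mul_eq_zero.1 h1.symm with h | h
        · omega
        · exact h
      simpa [this] using h2
    · intro h
      exact ⟨0, by simp, by simpa using h⟩
  have e1 : s' = s := Nat.dvd_antisymm
    (Int.natCast_dvd_natCast.1 ((hs ht' s).1 ((h _ _).1 ((hs ht s).2 dvd_rfl))))
    (Int.natCast_dvd_natCast.1 ((hs ht s').1 ((h _ _).2 ((hs ht' s').2 dvd_rfl))))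
  have e2 : t' = t := Nat.dvd_antisymm
    (Int.natCast_dvd_natCast.1 (by
      obtain ⟨n, h1, -⟩ := (h (-r) t).1 ⟨1, by simp, by simp⟩
      exact ⟨n, h1⟩))
    (Int.natCast_dvd_natCast.1 (by
      obtain ⟨n, h1, -⟩ := (h (-r') t').2 ⟨1, by simp, by simp⟩
      exact ⟨n, h1⟩))
  subst e1 e2
  refine ⟨rfl, rfl, ?_⟩
  obtain ⟨n, h1, h2⟩ := (h (-r') t').2 ⟨1, by simp, by simp⟩
  obtain rfl : n = 1 := by
    have : (t' : ℤ) * (n - 1) = 0 := by linear_combination -h1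
    rcases mul_eq_zero.1 this with h | h <;> omega
  rw [Int.modEq_iff_dvd]
  convert h2 using 1
  ring

/-- The relations between the generators in the opposite order, where `s = g s₁`, `r = g r₁` and
`u` is an inverse of `r₁` modulo `s₁`. -/
theorem rel_swap {s₁ t g r₁ u : ℤ} (hu : s₁ ∣ u * r₁ - 1) (i j : ℤ) :
    Rel (g * s₁) t (g * r₁) i j ↔ Rel (s₁ * t) g (t * u) j i := by
  obtain ⟨c, hc⟩ := hu
  constructor
  · rintro ⟨n, rfl, k, h⟩
    refine ⟨s₁ * k - r₁ * n, by linear_combination h, u * k - c * n, ?_⟩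
    linear_combination -(t * n) * hc
  · rintro ⟨m, rfl, k, h⟩
    refine ⟨s₁ * k - u * m, by linear_combination h, r₁ * k - c * m, ?_⟩
    linear_combination -(g * m) * hc

/-- The congruence `a ≡ ±b (mod m)`. -/
def ModEqNeg (m a b : ℤ) : Prop := a ≡ b [ZMOD m] ∨ a ≡ -b [ZMOD m]

theorem gcd_pos_of_one_le {s : ℕ} (hs : 1 ≤ s) (r : ℕ) : 0 < s.gcd r := Nat.gcd_pos_of_pos_left r hs

/-- Up to signs, an Ádám isomorphism matches the generators in the given order or interchanges
them. -/
theorem adamIsomorphic_iff_of_inverse {s t r s' t' r' : ℕ} (hs : 1 ≤ s) (ht : 1 ≤ t) (hs' : 1 ≤ s')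
    (ht' : 1 ≤ t') {u : ℤ}
    (hu : u * ((r / s.gcd r : ℕ) : ℤ) ≡ 1 [ZMOD ((s / s.gcd r : ℕ) : ℤ)]) :
    AdamIsomorphic s t r s' t' r' ↔
      (s' = s ∧ t' = t ∧ ModEqNeg s r' r) ∨
      (s' = s * t / s.gcd r ∧ t' = s.gcd r ∧
        ModEqNeg ((s * t / s.gcd r : ℕ) : ℤ) r' (t * u)) := by
  have := finite_cayGroup r hs ht
  have hg := gcd_pos_of_one_le hs r
  have hsw : ∀ i j, Rel s t r i j ↔ Rel ((s * t / s.gcd r : ℕ) : ℤ) (s.gcd r : ℕ) (t * u) j i := by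
    intro i j
    obtain ⟨s₁, hs₁⟩ := Nat.gcd_dvd_left s r
    obtain ⟨r₁, hr₁⟩ := Nat.gcd_dvd_right s r
    have e1 : s * t / s.gcd r = s₁ * t := by
      conv_lhs => rw [hs₁, mul_assoc]
      rw [← hs₁, Nat.mul_div_cancel_left _ hg]
    rw [Nat.div_eq_of_eq_mul_right hg hs₁, Nat.div_eq_of_eq_mul_right hg hr₁] at hu
    have := rel_swap (s₁ := s₁) (t := t) (g := (s.gcd r : ℕ)) (r₁ := r₁) (u := u)
      hu.symm.dvd i j
    rw [← Nat.cast_mul, ← Nat.cast_mul, ← hs₁, ← hr₁] at this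
    rw [e1, this]
    push_cast
    rfl
  have hcard : s * t = (s * t / s.gcd r) * s.gcd r :=
    (Nat.div_mul_cancel ((Nat.gcd_dvd_left s r).mul_right t)).symm
  rw [adamIsomorphic_iff, adam_iff]
  constructor
  · rintro ⟨τ, h⟩
    have hτ : ∀ i j : ℤ, Rel s t r i j ↔ i • τ (gen₁ s t r) + j • τ (gen₂ s t r) = 0 := by
      intro i j
      rw [← map_zsmul, ← map_zsmul, ← map_add, map_eq_zero_iff τ τ.injective, rel_iff]
    have hR : ∀ i j : ℤ, i • gen₁ s' t' r' + j • gen₂ s' t' r' = 0 ↔ Rel s' t' r' i j :=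
      rel_iff s' t' r'
    have hR' : ∀ i j : ℤ, i • gen₂ s' t' r' + j • gen₁ s' t' r' = 0 ↔ Rel s' t' r' j i :=
      fun i j => by rw [add_comm, hR]
    rcases h with ⟨h1, h2⟩ | ⟨h1, h2⟩
    · left
      have h3 : (∀ i j : ℤ, Rel s t r i j ↔ Rel s' t' r' i j) ∨
          (∀ i j : ℤ, Rel s t r i j ↔ Rel s' t' (-r') i j) := by
        rcases h1 with h1 | h1 <;> rcases h2 with h2 | h2 <;>
          simp only [h1, h2, zsmul_neg, ← neg_zsmul, hR] at hτ
        · exact Or.inl hτ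
        · exact Or.inr fun i j => by rw [hτ, rel_neg_right]
        · exact Or.inr fun i j => by rw [hτ, rel_neg_left]
        · exact Or.inl fun i j => by rw [hτ, rel_neg_neg]
      rcases h3 with h3 | h3
      · obtain ⟨e1, e2, e3⟩ := rel_unique ht ht' h3
        exact ⟨e1, e2, Or.inl e3⟩
      · obtain ⟨e1, e2, e3⟩ := rel_unique ht ht' h3
        exact ⟨e1, e2, Or.inr (by simpa using e3.neg)⟩
    · right
      have h3 : (∀ i j : ℤ, Rel ((s * t / s.gcd r : ℕ) : ℤ) (s.gcd r : ℕ) (t * u) i j ↔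
            Rel s' t' r' i j) ∨
          (∀ i j : ℤ, Rel ((s * t / s.gcd r : ℕ) : ℤ) (s.gcd r : ℕ) (t * u) i j ↔
            Rel s' t' (-r') i j) := by
        rcases h1 with h1 | h1 <;> rcases h2 with h2 | h2 <;>
          simp only [h1, h2, zsmul_neg, ← neg_zsmul, hR'] at hτ
        · exact Or.inl fun i j => by rw [← hsw, hτ]
        · exact Or.inr fun i j => by rw [← hsw, hτ, rel_neg_left]
        · exact Or.inr fun i j => by rw [← hsw, hτ, rel_neg_right]
        · exact Or.inl fun i j => by rw [← hsw, hτ, rel_neg_neg]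
      rcases h3 with h3 | h3
      · obtain ⟨e1, e2, e3⟩ := rel_unique hg ht' h3
        exact ⟨e1, e2, Or.inl e3⟩
      · obtain ⟨e1, e2, e3⟩ := rel_unique hg ht' h3
        exact ⟨e1, e2, Or.inr (by simpa using e3.neg)⟩
  · rintro (⟨rfl, rfl, h | h⟩ | ⟨rfl, rfl, h | h⟩)
    · obtain ⟨τ, h1, h2⟩ := exists_addEquiv_of_relations (generates_gen s' t' r)
        (generates_gen s' t' r') (by rw [card_cayGroup _ hs' ht', card_cayGroup _ hs' ht'])
        fun i j hij => by rwa [rel_iff, Rel.congr_mod h, ← rel_iff]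
      exact ⟨τ, Or.inl ⟨Or.inl h1, Or.inl h2⟩⟩
    · obtain ⟨τ, h1, h2⟩ := exists_addEquiv_of_relations (generates_gen s' t' r)
        (generates_gen s' t' r').neg (by rw [card_cayGroup _ hs' ht', card_cayGroup _ hs' ht'])
        fun i j hij => by
          rw [zsmul_neg, ← neg_zsmul, rel_iff, rel_neg_right, Rel.congr_mod h.neg, neg_neg,
            ← rel_iff, hij]
      exact ⟨τ, Or.inl ⟨Or.inl h1, Or.inr h2⟩⟩
    · obtain ⟨τ, h1, h2⟩ := exists_addEquiv_of_relations (generates_gen s t r)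
        (generates_gen (s * t / s.gcd r) (s.gcd r) r').swap
        (by rw [card_cayGroup _ hs ht, card_cayGroup _ hs' ht', ← hcard])
        fun i j hij => by
          rwa [add_comm, rel_iff, Rel.congr_mod h, ← hsw, ← rel_iff]
      exact ⟨τ, Or.inr ⟨Or.inl h1, Or.inl h2⟩⟩
    · obtain ⟨τ, h1, h2⟩ := exists_addEquiv_of_relations (generates_gen s t r)
        (generates_gen (s * t / s.gcd r) (s.gcd r) r').neg.swap
        (by rw [card_cayGroup _ hs ht, card_cayGroup _ hs' ht', ← hcard])
        fun i j hij => by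
          rw [add_comm, zsmul_neg, ← neg_zsmul, rel_iff, rel_neg_right, Rel.congr_mod h.neg,
            neg_neg, ← hsw, ← rel_iff, hij]
      exact ⟨τ, Or.inr ⟨Or.inr h1, Or.inl h2⟩⟩

theorem exists_inverse {s : ℕ} (hs : 1 ≤ s) (r : ℕ) :
    ∃ u : ℤ, u * ((r / s.gcd r : ℕ) : ℤ) ≡ 1 [ZMOD ((s / s.gcd r : ℕ) : ℤ)] := by
  obtain ⟨a, b, h⟩ := Nat.isCoprime_iff_coprime.2
    (Nat.coprime_div_gcd_div_gcd (gcd_pos_of_one_le hs r))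
  refine ⟨b, (Int.modEq_iff_dvd.2 ⟨a, ?_⟩)⟩
  linear_combination -h

theorem modEqNeg_iff {s r r' : ℕ} (hr : r < s) (hr' : r' < s) (h0 : r ≠ 0) :
    ModEqNeg s r' r ↔ r' = r ∨ r' = s - r := by
  unfold ModEqNeg
  refine or_congr ?_ ?_
  · rw [Int.natCast_modEq_iff]
    exact ⟨fun h => h.eq_of_lt_of_lt hr' hr, fun h => by rw [h]⟩
  · rw [show (r' : ℤ) ≡ -r [ZMOD s] ↔ (r' : ℤ) ≡ ((s - r : ℕ) : ℤ) [ZMOD s] from ?_,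
      Int.natCast_modEq_iff]
    · exact ⟨fun h => h.eq_of_lt_of_lt hr' (by omega), fun h => by rw [h]⟩
    · have : (-r : ℤ) ≡ ((s - r : ℕ) : ℤ) [ZMOD s] := by
        rw [Int.modEq_iff_dvd, Nat.cast_sub hr.le]
        exact ⟨1, by ring⟩
      exact ⟨fun h => h.trans this, fun h => h.trans this.symm⟩

theorem adamIsomorphic_iff_adamParams {s t r s' t' r' : ℕ} (hs : 1 ≤ s) (ht : 1 ≤ t) (hr : r < s)
    (hs' : 1 ≤ s') (ht' : 1 ≤ t') (hr' : r' < s') :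
    AdamIsomorphic s t r s' t' r' ↔ AdamParams s t r s' t' r' := by
  -- for `r = 0` the modulus `s / g` is one, so that `u = 0` is an inverse
  by_cases h0 : r = 0
  · subst h0
    have hu : (0 : ℤ) * ((0 / s.gcd 0 : ℕ) : ℤ) ≡ 1 [ZMOD ((s / s.gcd 0 : ℕ) : ℤ)] := by
      rw [Nat.gcd_zero_right, Nat.div_self hs]
      exact Int.modEq_one
    rw [adamIsomorphic_iff_of_inverse hs ht hs' ht' hu, AdamParams, Nat.gcd_zero_right,
      Nat.mul_div_cancel_left t hs]
    simp only [ModEqNeg, Nat.cast_zero, neg_zero, mul_zero, or_self, ne_eq, not_true_eq_false,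
      false_and, false_or, true_and]
    refine or_congr ?_ ?_
    · refine and_congr_right fun e => and_congr_right fun _ => ?_
      subst e
      constructor
      · intro h
        exact Nat.eq_zero_of_dvd_of_lt (by exact_mod_cast Int.modEq_zero_iff_dvd.1 h) hr'
      · rintro rfl
        rfl
    · rw [← Int.natCast_modEq_iff]
      rfl
  · have hP : AdamParams s t r s' t' r' ↔ ((s' = s ∧ t' = t ∧ (r' = r ∨ r' = s - r)) ∨
      (s' = s * t / s.gcd r ∧ t' = s.gcd r ∧
        ∃ u : ℤ, u * ((r / s.gcd r : ℕ) : ℤ) ≡ 1 [ZMOD ((s / s.gcd r : ℕ) : ℤ)] ∧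
          ((r' : ℤ) ≡ t * u [ZMOD ((s * t / s.gcd r : ℕ) : ℤ)] ∨
            (r' : ℤ) ≡ -(t * u) [ZMOD ((s * t / s.gcd r : ℕ) : ℤ)]))) := by
      simp [AdamParams, h0]
    rw [hP]
    constructor
    · intro h
      obtain ⟨u, hu⟩ := exists_inverse hs r
      rcases (adamIsomorphic_iff_of_inverse hs ht hs' ht' hu).1 h with ⟨rfl, e2, e3⟩ | ⟨e1, e2, e3⟩
      · exact Or.inl ⟨rfl, e2, (modEqNeg_iff hr hr' h0).1 e3⟩
      · exact Or.inr ⟨e1, e2, u, hu, e3⟩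
    · rintro (⟨rfl, e2, e3⟩ | ⟨e1, e2, u, hu, e3⟩)
      · obtain ⟨u, hu⟩ := exists_inverse hs r
        exact (adamIsomorphic_iff_of_inverse hs ht hs' ht' hu).2
          (Or.inl ⟨rfl, e2, (modEqNeg_iff hr hr' h0).2 e3⟩)
      · exact (adamIsomorphic_iff_of_inverse hs ht hs' ht' hu).2 (Or.inr ⟨e1, e2, e3⟩)

/-- The number `k d₁ / g` represents the class of `r / g` modulo `s / g` and is invertible modulo
`s t / g`. -/
theorem IsAux.modEq_and_coprime {s t r k : ℕ} (hs : 1 ≤ s) (hk : IsAux s t r k) :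
    k * d₁ s t r / s.gcd r ≡ r / s.gcd r [MOD s / s.gcd r] ∧
      (k * d₁ s t r / s.gcd r).Coprime (s * t / s.gcd r) := by
  obtain ⟨-, -, hkt, hkr⟩ := hk
  have hg := gcd_pos_of_one_le hs r
  have hdg : d₁ s t r ∣ s.gcd r := by
    unfold d₁
    exact Nat.dvd_gcd ((Nat.gcd_dvd_left _ _).trans (Nat.gcd_dvd_left _ _)) (Nat.gcd_dvd_right _ _)
  have hd : 0 < d₁ s t r := Nat.pos_of_dvd_of_pos hdg hg
  have h1 : k * d₁ s t r ≡ r [MOD s] := by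
    have := hkr.mul_right' (d₁ s t r)
    rwa [Nat.div_mul_cancel (hdg.trans (Nat.gcd_dvd_right s r)),
      Nat.div_mul_cancel (hdg.trans (Nat.gcd_dvd_left s r))] at this
  have h2 : s.gcd (k * d₁ s t r) = s.gcd r := by
    rw [Nat.gcd_comm, h1.gcd_eq, Nat.gcd_comm]
  have hgk : s.gcd r ∣ k * d₁ s t r := h2 ▸ Nat.gcd_dvd_right _ _
  refine ⟨?_, ?_⟩
  · refine Nat.ModEq.mul_right_cancel' hg.ne' ?_
    rwa [Nat.div_mul_cancel hgk, Nat.div_mul_cancel (Nat.gcd_dvd_right s r),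
      Nat.div_mul_cancel (Nat.gcd_dvd_left s r)]
  · rw [mul_comm s t, Nat.mul_div_assoc _ (Nat.gcd_dvd_left s r)]
    refine Nat.Coprime.mul_right ?_ ?_
    · obtain ⟨e, he⟩ := hdg
      refine Nat.Coprime.coprime_dvd_left ?_ hkt
      rw [he] at hgk ⊢
      rw [mul_comm k, Nat.mul_div_mul_left _ _ hd]
      rw [mul_comm k] at hgk
      exact Nat.div_dvd_of_dvd (Nat.dvd_of_mul_dvd_mul_left hd hgk)
    · rw [← h2]
      exact (Nat.coprime_div_gcd_div_gcd (h2 ▸ hg)).symm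

theorem adamIsomorphic_iff_adamParamsAux {s t r k s' t' r' : ℕ} (hs : 1 ≤ s) (ht : 1 ≤ t)
    (hr : r < s) (hs' : 1 ≤ s') (ht' : 1 ≤ t') (hr' : r' < s') (h0 : r ≠ 0) (hk : IsAux s t r k) :
    AdamIsomorphic s t r s' t' r' ↔ AdamParamsAux s t r k s' t' r' := by
  obtain ⟨hmod, hcop⟩ := hk.modEq_and_coprime hs
  have hlift : ∀ {U : ℤ}, (U : ZMod (s * t / s.gcd r)) *
      ((k * d₁ s t r / s.gcd r : ℕ) : ZMod (s * t / s.gcd r)) = 1 →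
      (U * ((r / s.gcd r : ℕ) : ℤ) ≡ 1 [ZMOD ((s / s.gcd r : ℕ) : ℤ)]) := by
    intro U hU
    have h1 : U * ((k * d₁ s t r / s.gcd r : ℕ) : ℤ) ≡ 1 [ZMOD ((s * t / s.gcd r : ℕ) : ℤ)] := by
      rw [← ZMod.intCast_eq_intCast_iff]
      rw [Int.cast_mul, Int.cast_natCast, Int.cast_one]
      exact hU
    have h2 : ((s / s.gcd r : ℕ) : ℤ) ∣ ((s * t / s.gcd r : ℕ) : ℤ) := by
      rw [mul_comm s t, Nat.mul_div_assoc _ (Nat.gcd_dvd_left s r)]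
      exact Int.natCast_dvd_natCast.2 (dvd_mul_left _ _)
    exact ((Int.natCast_modEq_iff.2 hmod).symm.mul_left U).trans (h1.of_dvd h2)
  have hsign : ∀ U : ℤ, ModEqNeg ((s * t / s.gcd r : ℕ) : ℤ) r' (t * U) ↔
      ((r' : ZMod (s * t / s.gcd r)) = t * (U : ZMod (s * t / s.gcd r)) ∨
        (r' : ZMod (s * t / s.gcd r)) = -(t * (U : ZMod (s * t / s.gcd r)))) := by
    intro U
    unfold ModEqNeg
    rw [← ZMod.intCast_eq_intCast_iff, ← ZMod.intCast_eq_intCast_iff]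
    push_cast
    rfl
  constructor
  · intro h
    obtain ⟨U, hU⟩ := ZMod.intCast_surjective
      (((k * d₁ s t r / s.gcd r : ℕ) : ZMod (s * t / s.gcd r))⁻¹)
    have hU1 : (U : ZMod (s * t / s.gcd r)) *
        ((k * d₁ s t r / s.gcd r : ℕ) : ZMod (s * t / s.gcd r)) = 1 := by
      rw [hU]
      exact (mul_comm _ _).trans (ZMod.coe_mul_inv_eq_one _ hcop)
    rcases (adamIsomorphic_iff_of_inverse hs ht hs' ht' (hlift hU1)).1 h with
      ⟨rfl, e2, e3⟩ | ⟨e1, e2, e3⟩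
    · exact Or.inl ⟨rfl, e2, (modEqNeg_iff hr hr' h0).1 e3⟩
    · exact Or.inr ⟨e1, e2, U, hU1, (hsign U).1 e3⟩
  · rintro (⟨rfl, e2, e3⟩ | ⟨e1, e2, u, hu, e3⟩)
    · obtain ⟨u, hu⟩ := exists_inverse hs r
      exact (adamIsomorphic_iff_of_inverse hs ht hs' ht' hu).2
        (Or.inl ⟨rfl, e2, (modEqNeg_iff hr hr' h0).2 e3⟩)
    · obtain ⟨U, rfl⟩ := ZMod.intCast_surjective u
      exact (adamIsomorphic_iff_of_inverse hs ht hs' ht' (hlift hu)).2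
        (Or.inr ⟨e1, e2, (hsign U).2 e3⟩)

/-! ### The exceptional graphs -/

theorem twisted_iff_rel {s t r : ℕ} : Twisted (gen₁ s t r) (gen₂ s t r) ↔
    (¬ Rel s t r 1 (-1) ∧ Rel s t r 2 (-2)) ∨ (¬ Rel s t r 1 1 ∧ Rel s t r 2 2) := by
  simp only [← rel_iff, Twisted]
  refine or_congr (and_congr (not_congr ?_) ?_) (and_congr (not_congr ?_) ?_)
  all_goals
    constructor <;> intro h <;> linear_combination (norm := module) h

theorem rel_one {s r i j : ℤ} : Rel s 1 r i j ↔ s ∣ i + r * j :=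
  ⟨fun ⟨n, h1, h2⟩ => by rwa [h1, one_mul], fun h => ⟨j, (one_mul j).symm, h⟩⟩

theorem rel_two {s r i k : ℤ} : Rel s 2 r i (2 * k) ↔ s ∣ i + r * k :=
  ⟨fun ⟨n, h1, h2⟩ => by rwa [show k = n by omega], fun h => ⟨k, rfl, h⟩⟩

theorem not_rel_two {s r i j : ℤ} (hj : ¬ 2 ∣ j) : ¬ Rel s 2 r i j :=
  fun ⟨n, h1, _⟩ => hj ⟨n, h1⟩

theorem twisted_iff {n s t r : ℕ} (hn : 1 ≤ n) (ht : 1 ≤ t) (hr : r < s) (hst : s * t = 4 * n) :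
    Twisted (gen₁ s t r) (gen₂ s t r) ↔
      (s = 4 * n ∧ t = 1 ∧ (r = 2 * n - 1 ∨ r = 2 * n + 1)) ∨
        (s = 2 * n ∧ t = 2 ∧ (r = 2 ∨ r = 2 * n - 2)) := by
  rw [twisted_iff_rel]
  by_cases ht1 : t = 1
  · -- `2 ± 2r = 4n c` and `0 ≤ r < 4n` leave two values of `c`, and one of them means `r = ∓1`
    subst ht1
    obtain rfl : s = 4 * n := by omega
    simp only [Nat.cast_one, rel_one]
    push_cast
    constructor
    · rintro (⟨h1, c, h2⟩ | ⟨h1, c, h2⟩)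
      · have hc : c ≤ 0 := by by_contra!; nlinarith
        have hc' : -2 < c := by by_contra!; nlinarith
        obtain rfl | rfl : c = 0 ∨ c = -1 := by omega
        · exact absurd ⟨0, by linarith⟩ h1
        · have h3 : r = 2 * n + 1 := by omega
          simp [h3]
      · have hc : c ≤ 2 := by by_contra!; nlinarith
        have hc' : 0 < c := by by_contra!; nlinarith
        obtain rfl | rfl : c = 1 ∨ c = 2 := by omega
        · have h3 : r = 2 * n - 1 := by omega
          simp [h3]
        · exact absurd ⟨1, by linarith⟩ h1
    · intro h
      have h : r = 2 * n - 1 ∨ r = 2 * n + 1 := by omega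
      rcases h with h | h
      · refine Or.inr ⟨?_, 1, by omega⟩
        rintro ⟨c, h1⟩
        have h2 : (n : ℤ) * (4 * c - 2) = 0 := by
          have : (r : ℤ) = 2 * n - 1 := by omega
          rw [this] at h1
          linarith
        rcases mul_eq_zero.1 h2 with h2 | h2 <;> omega
      · refine Or.inl ⟨?_, -1, by omega⟩
        rintro ⟨c, h1⟩
        have h2 : (n : ℤ) * (4 * c + 2) = 0 := by
          have : (r : ℤ) = 2 * n + 1 := by omega
          rw [this] at h1
          linarith
        rcases mul_eq_zero.1 h2 with h2 | h2 <;> omega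
  by_cases ht2 : t = 2
  · subst ht2
    obtain rfl : s = 2 * n := by omega
    have h1 : ¬ Rel (2 * n : ℕ) 2 r 1 (-1) := not_rel_two (by decide)
    have h2 : ¬ Rel (2 * n : ℕ) 2 r 1 1 := not_rel_two (by decide)
    simp only [Nat.cast_ofNat, h1, h2, not_false_eq_true, true_and,
      show (-2 : ℤ) = 2 * -1 by norm_num]
    rw [rel_two, show Rel (2 * n : ℕ) 2 r 2 2 ↔ _ from rel_two (k := 1)]
    push_cast
    constructor
    · rintro (⟨c, h⟩ | ⟨c, h⟩)
      · have hc : c < 2 := by by_contra!; nlinarith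
        have hc' : -1 < c := by by_contra!; nlinarith
        obtain rfl | rfl : c = 0 ∨ c = 1 := by omega
        all_goals omega
      · have hc : c < 2 := by by_contra!; nlinarith
        have hc' : 0 < c := by by_contra!; nlinarith
        obtain rfl : c = 1 := by omega
        omega
    · intro h
      have h : r = 2 ∨ r = 2 * n - 2 := by omega
      rcases h with rfl | rfl
      · exact Or.inl ⟨0, by norm_num⟩
      · exact Or.inr ⟨1, by omega⟩
  · -- the second generator has order `t` modulo the first one, so `t` divides two
    have h3 : ¬ (t : ℤ) ∣ 2 := fun h => by
      have h4 : t ∣ 2 := Int.natCast_dvd_natCast.1 h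
      have := Nat.le_of_dvd two_pos h4
      omega
    constructor
    · rintro (⟨-, c, h, -⟩ | ⟨-, c, h, -⟩)
      · exact absurd ⟨-c, by linarith⟩ h3
      · exact absurd ⟨c, by linarith⟩ h3
    · rintro (⟨-, h, -⟩ | ⟨-, h, -⟩) <;> omega

theorem isomorphic_of_adam {s t r s' t' r' : ℕ} (hs : 1 ≤ s) (ht : 1 ≤ t) (hs' : 1 ≤ s')
    (ht' : 1 ≤ t') (h : AdamIsomorphic s t r s' t' r') :
    Isomorphic (X s t r) (X s' t' r') := by
  classical
  rw [isomorphic_iff hs ht hs' ht']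
  obtain ⟨τ, h⟩ := adamIsomorphic_iff.1 h
  refine ⟨τ.toEquiv, fun x y => ?_⟩
  simp only [mult, ← h, AddEquiv.toEquiv_eq_coe, AddEquiv.coe_toEquiv, ← map_sub]
  convert Multiset.count_map_eq_count' _ _ τ.injective _

theorem isomorphic_symm {s t r s' t' r' : ℕ} (hs : 1 ≤ s) (ht : 1 ≤ t) (hs' : 1 ≤ s')
    (ht' : 1 ≤ t') (h : Isomorphic (X s t r) (X s' t' r')) :
    Isomorphic (X s' t' r') (X s t r) := by
  rw [isomorphic_iff hs ht hs' ht'] at h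
  rw [isomorphic_iff hs' ht' hs ht]
  obtain ⟨f, hf⟩ := h
  exact ⟨f.symm, hf.symm⟩

theorem twisted_exceptional {n : ℕ} (hn : 1 ≤ n) :
    Twisted (gen₁ (4 * n) 1 (2 * n - 1)) (gen₂ (4 * n) 1 (2 * n - 1)) :=
  (twisted_iff hn le_rfl (by omega) (by ring)).2 (Or.inl ⟨rfl, rfl, Or.inl rfl⟩)

theorem isomorphic_exceptional_iff {n s t r : ℕ} (hn : 1 ≤ n) (hs : 1 ≤ s) (ht : 1 ≤ t) :
    Isomorphic (X (4 * n) 1 (2 * n - 1)) (X s t r) ↔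
      s * t = 4 * n ∧ Twisted (gen₁ s t r) (gen₂ s t r) := by
  have h4 : 1 ≤ 4 * n := by omega
  have := finite_cayGroup (2 * n - 1) h4 le_rfl
  have := finite_cayGroup r hs ht
  have hc := card_cayGroup (2 * n - 1) h4 le_rfl
  have hc' := card_cayGroup r hs ht
  rw [isomorphic_iff h4 le_rfl hs ht]
  constructor
  · rintro ⟨f, hf⟩
    refine ⟨?_, hf.twisted (twisted_exceptional hn)⟩
    rw [← hc', ← Nat.card_congr f, hc, mul_one]
  · rintro ⟨h, ht⟩
    exact exists_isCayleyIso_of_twisted (generates_gen _ _ _) (generates_gen _ _ _)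
      (twisted_exceptional hn) ht (by rw [hc, hc', h, mul_one])

/-! ### Isomorphism and Ádám isomorphism -/

theorem isomorphic_iff_adamIsomorphic {s t r s' t' r' : ℕ} (hs : 1 ≤ s) (ht : 1 ≤ t)
    (hs' : 1 ≤ s') (ht' : 1 ≤ t')
    (hex : ∀ n : ℕ, 1 ≤ n → ¬ Isomorphic (X s t r) (X (4 * n) 1 (2 * n - 1))) :
    Isomorphic (X s t r) (X s' t' r') ↔ AdamIsomorphic s t r s' t' r' := by
  refine ⟨fun h => ?_, isomorphic_of_adam hs ht hs' ht'⟩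
  obtain ⟨f, hf⟩ := (isomorphic_iff hs ht hs' ht').1 h
  have := finite_cayGroup r hs ht
  rw [adamIsomorphic_iff]
  by_cases htw : Twisted (gen₁ s t r) (gen₂ s t r)
  · obtain ⟨m, hm⟩ := htw.even_card
    rcases Nat.even_or_odd' m with ⟨n, rfl | rfl⟩
    · rw [card_cayGroup r hs ht] at hm
      have hn : 1 ≤ n := by
        rcases Nat.eq_zero_or_pos n with rfl | hn
        · have := Nat.mul_pos hs ht
          omega
        · exact hn
      exact absurd (isomorphic_symm (by omega) le_rfl hs ht ((isomorphic_exceptional_iff hn hs ht).2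
        ⟨by rw [hm]; ring, htw⟩)) (hex n hn)
    · exact htw.adam_of_odd (generates_gen _ _ _) (generates_gen _ _ _) (hf.twisted htw)
        ⟨n, rfl⟩ hm ((Nat.card_congr f).symm.trans hm)
  · exact adam_of_not_twisted (generates_gen _ _ _) (generates_gen _ _ _) hf htw

/-! ### The fundamental 2-factorizations -/

/-- Along an edge of the colour that is mapped to the red colour of `X(2n, 2, 2)`, the row of the
image is constant. Each colour of `X(4n, 1, 2n - 1)` is connected, so all images lie in one row. -/
theorem not_preservesFundamental {n : ℕ} (hn : 1 ≤ n)
    (φ : MultiIso (X (4 * n) 1 (2 * n - 1)) (X (2 * n) 2 2)) : ¬ φ.PreservesFundamental := by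
  intro h
  have : NeZero (4 * n) := ⟨by omega⟩
  have h1 : red (2 * n) 2 ∈ φ.edgeImage '' fundamental (4 * n) 1 := by
    rw [show φ.edgeImage '' fundamental (4 * n) 1 = _ from h]
    exact Or.inl rfl
  obtain ⟨F, hF, hFr⟩ := h1
  let row : Vert (4 * n) 1 → Fin 2 := fun v => ((φ.vertexEquiv ⟨v, trivial⟩ : Vert (2 * n) 2)).1
  have hrow : ∀ e ∈ F, ∀ x y, ends (4 * n) 1 (2 * n - 1) e = s(x, y) → row x = row y := by
    intro e he x y hxy
    have h2 := (φ.isLink_iff ⟨e, trivial⟩ ⟨x, trivial⟩ ⟨y, trivial⟩).1 hxy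
    have h3 : (φ.edgeEquiv ⟨e, trivial⟩ : Edge (2 * n) 2) ∈ red (2 * n) 2 := by
      rw [← hFr]
      exact ⟨⟨e, trivial⟩, he, rfl⟩
    obtain ⟨w, hw⟩ := h3
    rw [← hw] at h2
    change s(w, (w.1, w.2 + 1)) = s(_, _) at h2
    rcases Sym2.eq_iff.1 h2 with ⟨h4, h5⟩ | ⟨h4, h5⟩
    · simp only [row]; rw [← h4, ← h5]
    · simp only [row]; rw [← h4, ← h5]
  -- both steps, `1` and `2n - 1`, are their own inverses modulo `4n`, hence generate
  have hstep : ∃ c : ZMod (4 * n), c * c = 1 ∧ ∀ x, row (0, x + c) = row (0, x) := by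
    rcases hF with rfl | rfl
    · exact ⟨1, one_mul 1, fun x => (hrow (Sum.inl (0, x)) ⟨_, rfl⟩ _ _ rfl).symm⟩
    · refine ⟨((2 * n - 1 : ℕ) : ZMod (4 * n)), ?_, fun x =>
        (hrow (Sum.inr (0, x)) ⟨_, rfl⟩ _ _ (by simp [ends, up])).symm⟩
      obtain ⟨m, rfl⟩ : ∃ m, n = m + 1 := ⟨n - 1, by omega⟩
      have h2 : (((2 * (m + 1) - 1) * (2 * (m + 1) - 1) : ℕ) : ZMod (4 * (m + 1))) = (1 : ℕ) := by
        rw [ZMod.natCast_eq_natCast_iff, show 2 * (m + 1) - 1 = 2 * m + 1 by omega,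
          show (2 * m + 1) * (2 * m + 1) = 1 + 4 * (m + 1) * m by ring]
        simp [Nat.ModEq]
      rw [← Nat.cast_mul, h2, Nat.cast_one]
  obtain ⟨c, hc, hstep⟩ := hstep
  have hconst : ∀ x, row (0, x) = row (0, 0) := fun x => by
    have h2 : ∀ k : ℕ, row (0, k • c) = row (0, 0) := fun k => by
      induction k with
      | zero => simp
      | succ k ih => rw [succ_nsmul, hstep, ih]
    have h3 : x = (x * c).val • c := by
      rw [nsmul_eq_mul, ZMod.natCast_zmod_val, mul_assoc, hc, mul_one]
    rw [h3, h2]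
  have hsurj : ∀ i : Fin 2, ∃ v, row v = i := fun i =>
    ⟨(φ.vertexEquiv.symm ⟨(i, 0), trivial⟩).1, by
      change ((φ.vertexEquiv (φ.vertexEquiv.symm ⟨(i, 0), trivial⟩)) : Vert (2 * n) 2).1 = i
      rw [Equiv.apply_symm_apply]⟩
  obtain ⟨⟨i, x⟩, hx⟩ := hsurj 0
  obtain ⟨⟨j, y⟩, hy⟩ := hsurj 1
  rw [Subsingleton.elim i 0, hconst] at hx
  rw [Subsingleton.elim j 0, hconst, hx] at hy
  exact absurd hy (by decide)

end Xstr

theorem mainTheorem9 :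
    -- the graphs isomorphic to `X(4n, 1, 2n - 1)`
    (∀ n : ℕ, 1 ≤ n → ∀ s' t' r' : ℕ, 1 ≤ s' → 1 ≤ t' → r' < s' →
      (Xstr.Isomorphic (Xstr.X (4 * n) 1 (2 * n - 1)) (Xstr.X s' t' r') ↔
        (s' = 4 * n ∧ t' = 1 ∧ (r' = 2 * n - 1 ∨ r' = 2 * n + 1)) ∨
          (s' = 2 * n ∧ t' = 2 ∧ (r' = 2 ∨ r' = 2 * n - 2)))) ∧
    -- no isomorphism with `X(2n, 2, 2)` respects the fundamental 2-factorizations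
    (∀ n : ℕ, 1 ≤ n →
      ¬ ∃ φ : Xstr.MultiIso (Xstr.X (4 * n) 1 (2 * n - 1)) (Xstr.X (2 * n) 2 2),
        φ.PreservesFundamental) ∧
    -- all other parameters
    (∀ s t r s' t' r' : ℕ, 1 ≤ s → 1 ≤ t → r < s → 1 ≤ s' → 1 ≤ t' → r' < s' →
      (∀ n : ℕ, 1 ≤ n →
        ¬ Xstr.Isomorphic (Xstr.X s t r) (Xstr.X (4 * n) 1 (2 * n - 1)) ∧
        ¬ Xstr.Isomorphic (Xstr.X s t r) (Xstr.X (2 * n) 2 2)) →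
      (Xstr.Isomorphic (Xstr.X s t r) (Xstr.X s' t' r') ↔
        Xstr.AdamIsomorphic s t r s' t' r') ∧
      (Xstr.AdamIsomorphic s t r s' t' r' ↔ Xstr.AdamParams s t r s' t' r') ∧
      (r ≠ 0 → ∀ k : ℕ, Xstr.IsAux s t r k →
        (Xstr.AdamIsomorphic s t r s' t' r' ↔ Xstr.AdamParamsAux s t r k s' t' r'))) := by
  refine ⟨fun n hn s' t' r' hs' ht' hr' => ?_, fun n hn ⟨φ, hφ⟩ =>
    Xstr.not_preservesFundamental hn φ hφ, fun s t r s' t' r' hs ht hr hs' ht' hr' hex =>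
    ⟨Xstr.isomorphic_iff_adamIsomorphic hs ht hs' ht' fun n hn => (hex n hn).1,
      Xstr.adamIsomorphic_iff_adamParams hs ht hr hs' ht' hr', fun h0 k hk =>
      Xstr.adamIsomorphic_iff_adamParamsAux hs ht hr hs' ht' hr' h0 hk⟩⟩
  rw [Xstr.isomorphic_exceptional_iff hn hs' ht']
  constructor
  · rintro ⟨h1, h2⟩
    exact (Xstr.twisted_iff hn ht' hr' h1).1 h2
  · intro h
    have h1 : s' * t' = 4 * n := by
      rcases h with ⟨rfl, rfl, -⟩ | ⟨rfl, rfl, -⟩ <;> ring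
    exact ⟨h1, (Xstr.twisted_iff hn ht' hr' h1).2 h⟩
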